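/- **Theorem 2 (lower bound).** There is an absolute constant $c>0$ such that the following holds. Let $E$ be a separable real Hilbert space (of finite or countably infinite dimension), and let $\mathcal D_S,\mathcal D_T$ (source, target) be probability distributions of $(x,y)\in E\times\mathbb R$ with $\mathbb E\|x\|^4<\infty$. Put $G=\mathbb E_{\mathcal D_S}[xx^\top]$, $H=\mathbb E_{\mathcal D_T}[xx^\top]$, with orthonormal eigenbases and eigenvalues $(\mu_j)$ of $G$ and $(\lambda_k)$ of $H$. For an index set $\mathbb J$ let $G_{\mathbb J}=\sum_{j\in\mathbb J}\mu_j u_ju_j^\top$, $G_{\mathbb J}^{-1}=\sum_{j\in\mathbb J}\mu_j^{-1}u_ju_j^\top$, $I_{\mathbb J}=\sum_{j\in\mathbb J}u_ju_j^\top$, where $u_j$ are the eigenvectors of $G$; define $H_{\mathbb K}$, $I_{\mathbb K}$ likewise from $H$. Write $\|v\|_A^2=\langle v,Av\rangle$. Assume: * there is $\beta>0$ such that for every positive semidefinite bounded operator $A$, $\mathbb E_{\mathcal D_S}[xx^\top Axx^\top]-GAG\succeq\beta\,\mathrm{tr}(GA)\,G$ and $\mathbb E_{\mathcal D_T}[xx^\top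 Axx^\top]-HAH\succeq\beta\,\mathrm{tr}(HA)\,H$; * for some $w^*\in E$ and $\sigma>0$, under both distributions $y=\langle w^*,x\rangle+\epsilon$ with $\epsilon\sim\mathcal N(0,\sigma^2)$ independent of $x$; * $M_{\rm eff}:=M/\log M\ge10$, $N_{\rm eff}:=N/\log N\ge10$, $0<\gamma_0<1/\|G\|$ and $0<\gamma_M<1/\|H\|$. Let $(x_t,y_t)_{t=1}^{M+N}$ be independent, drawn from $\mathcal D_S$ for $t\le M$ and from $\mathcal D_T$ for $t>M$. Let $w_0\in E$ and $w_t=w_{t-1}-\gamma_{t-1}(x_tx_t^\top w_{t-1}-x_ty_t)$, where $\gamma_t=\gamma_0/2^{\lfloor t/M_{\rm eff}\rfloor}$ for $0\le t<M$ and $\gamma_t=\gamma_M/2^{\lfloor (t-M)/N_{\rm eff}\rfloor}$ for $M\le t<M+N$. Let $\mathcal R_T(w)=\tfrac12\mathbb E_{\mathcal D_T}(y-\langle w,x\rangle)^2$ and $\Delta(w)=\mathcal R_T(w)-\mathcal R_T(w^*)$. Define $B_0=(w_0-w^*)(w_0-w^*)^\top$, $C_0=0$ and, for $t=1,\dots,M+N$,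 with $\mathbb E_t$ the expectation under the distribution of the $t$-th sample and $\Sigma_t=\mathbb E_t[xx^\top]$, $$B_t=B_{t-1}-\gamma_{t-1}(\Sigma_tB_{t-1}+B_{t-1}\Sigma_t)+\gamma_{t-1}^2\mathbb E_t[xx^\top B_{t-1}xx^\top],$$ $$C_t=C_{t-1}-\gamma_{t-1}(\Sigma_tC_{t-1}+C_{t-1}\Sigma_t)+\gamma_{t-1}^2\mathbb E_t[xx^\top C_{t-1}xx^\top]+\gamma_{t-1}^2\mathbb E_t[(y-\langle w^*,x\rangle)^2xx^\top].$$ Set $\mathrm{Bias}=\tfrac12\mathrm{tr}(HB_{M+N})$ and $\mathrm{Var}=\tfrac12\mathrm{tr}(HC_{M+N})$. Then $\Delta(w_{M+N})$ is integrable and $$\mathbb E[\Delta(w_{M+N})]=\mathrm{Bias}+\mathrm{Var}.$$ Moreover, with $\mathbb J=\{j:\mu_j\ge1/(\gamma_0M_{\rm eff})\}$, $\mathbb K=\{k:\lambda_k\ge1/(\gamma_MN_{\rm eff})\}$, $$D^{\rm ft}=\mathrm{tr}\Big(\prod_{t=0}^{N-1}(I-\gamma_{M+t}H)^2H\,(G_{\mathbb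 J}^{-1}+M_{\rm eff}^2\gamma_0^2G_{\mathbb J^c})\Big),\qquad D=|\mathbb K|+N_{\rm eff}^2\gamma_M^2\sum_{i\notin\mathbb K}\lambda_i^2,$$ $v=\prod_{t=0}^{M-1}(I-\gamma_tG)(w_0-w^*)$ and $u=\prod_{t=M}^{M+N-1}(I-\gamma_tH)v$, one has $$\mathrm{Var}\ge c\,V,\qquad V:=\sigma^2\Big(\frac{D^{\rm ft}}{M_{\rm eff}}+\frac{D}{N_{\rm eff}}\Big),$$ $$\mathrm{Bias}\ge c\,L,\qquad L:=\|u\|_H^2+\beta\|w_0-w^*\|^2_{G_{\mathbb J^c}}\frac{D^{\rm ft}}{M_{\rm eff}}+\beta\|v\|^2_{H_{\mathbb K^c}}\frac{D}{N_{\rm eff}}.$$ Finally, for $\alpha\ge\beta$ let $Q=\|w_0-w^*\|^2_{\frac{I_{\mathbb J}}{M_{\rm eff}\gamma_0}+G_{\mathbb J^c}}$ and let $$U_\alpha:=\|u\|_H^2+\alpha Q\,\frac{D^{\rm ft}}{M_{\rm eff}}+\alpha\Big(\|v\|^2_{\frac{I_{\mathbb K}}{N_{\rm eff}\gamma_M}+H_{\mathbb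 K^c}}+Q\Big)\frac{D}{N_{\rm eff}}$$ be the bias expression of the corresponding upper bound. If $\|w_0-w^*\|_G^2\le R\sigma^2$ and $\|v\|_H^2\le R\sigma^2$, then $V+L\le V+U_\alpha$ and $c\,(V+U_\alpha)\le(1+\alpha R)(V+L)$, that is, the lower and upper expressions match up to constants. -/

import Mathlib

open MeasureTheory ProbabilityTheory
open scoped RealInnerProductSpace

namespace CovShift

noncomputable section

variable {E : Type*} [NormedAddCommGroup E] [InnerProductSpace ℝ E]

/-! ### Hilbert space notation -/

/-- The operator `x xᵀ : v ↦ ⟪x, v⟫ x`. -/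
def outer (x : E) : E →L[ℝ] E := InnerProductSpace.rankOne ℝ x x

/-- The trace `∑ i, ⟪b i, A (b i)⟫` of an operator, computed in the orthonormal basis `b`. It is only
applied to trace class operators, for which the series converges absolutely and the value does
not depend on `b`. -/
def trace {ι : Type*} (b : HilbertBasis ι ℝ E) (A : E →L[ℝ] E) : ℝ := ∑' i, ⟪b i, A (b i)⟫

/-- `‖v‖²_A = vᵀ A v`. -/
def sqNorm (A : E →L[ℝ] E) (v : E) : ℝ := ⟪v, A v⟫

/-- `∑_{i ∈ S} f i • b i (b i)ᵀ`. For an eigenbasis `b` of `A` with eigenvalues `f` this is `A_S`;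
with `f⁻¹` in place of `f` it is `A_S⁻¹`, and with a constant `a` it is `a I_S`. -/
def specPart {ι : Type*} (b : HilbertBasis ι ℝ E) (f : ι → ℝ) (S : Set ι) : E →L[ℝ] E :=
  ∑' i : S, f i • outer (b i)

/-- `b` is an orthonormal basis of eigenvectors of `A`, with eigenvalues `ev`. -/
def IsEigenbasis {ι : Type*} (A : E →L[ℝ] E) (b : HilbertBasis ι ℝ E) (ev : ι → ℝ) : Prop :=
  ∀ i, A (b i) = ev i • b i

/-! ### Data distributions on pairs `(x, y)` -/

variable [MeasurableSpace E]

/-- `𝔼[x xᵀ]`. -/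
def covOp (D : Measure (E × ℝ)) : E →L[ℝ] E := ∫ z, outer z.1 ∂D

/-- `𝔼[x xᵀ A x xᵀ]`. -/
def fourthOp (D : Measure (E × ℝ)) (A : E →L[ℝ] E) : E →L[ℝ] E :=
  ∫ z, outer z.1 * A * outer z.1 ∂D

/-- `𝔼[(y - ⟪w, x⟫)² x xᵀ]`. -/
def noiseOp (D : Measure (E × ℝ)) (w : E) : E →L[ℝ] E :=
  ∫ z, (z.2 - ⟪w, z.1⟫) ^ 2 • outer z.1 ∂D

/-- `½ 𝔼 (y - ⟪w, x⟫)²`. -/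
def risk (D : Measure (E × ℝ)) (w : E) : ℝ := (1 / 2) * ∫ z, (z.2 - ⟪w, z.1⟫) ^ 2 ∂D

/-- Excess risk of `w` relative to the risk minimizer `wstar`. -/
def excessRisk (D : Measure (E × ℝ)) (wstar w : E) : ℝ := risk D w - risk D wstar

/-- The covariates have a finite fourth moment, and for every positive semidefinite `A`,
`𝔼[x xᵀ A x xᵀ] - G A G ⪰ β tr(G A) G`, where `G = 𝔼[x xᵀ]` (the order is the Loewner order). The
trace is computed in the orthonormal basis `b`. -/
structure FourthMomentLower {ι : Type*} (D : Measure (E × ℝ)) (b : HilbertBasis ι ℝ E) (β : ℝ) :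
    Prop where
  finite_fourth : Integrable (fun z : E × ℝ => ‖z.1‖ ^ 4) D
  lower : ∀ A : E →L[ℝ] E, A.IsPositive →
    (β * trace b (covOp D * A)) • covOp D ≤ fourthOp D A - covOp D * A * covOp D

/-- Under `D` the response is `y = ⟪wstar, x⟫ + ε` with `ε ∼ 𝒩(0, σ²)` independent of `x`. -/
structure WellSpecified (D : Measure (E × ℝ)) (wstar : E) (σ : ℝ) : Prop where
  noise_law : HasLaw (fun z : E × ℝ => z.2 - ⟪wstar, z.1⟫)
    (gaussianReal 0 ⟨σ ^ 2, sq_nonneg σ⟩) D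
  noise_indep : IndepFun (fun z : E × ℝ => z.1) (fun z : E × ℝ => z.2 - ⟪wstar, z.1⟫) D

/-! ### Stepsizes and SGD -/

/-- Effective sample size `n / log n`. -/
def nEff (n : ℕ) : ℝ := n / Real.log n

/-- Geometrically decaying stepsizes: `γ₀ / 2^⌊t / M_eff⌋` for `t < M` (pretraining), and
`γ_M / 2^⌊(t - M) / N_eff⌋` for `t ≥ M` (finetuning). -/
def stepsize (M N : ℕ) (γ₀ γM : ℝ) (t : ℕ) : ℝ :=
  if t < M then γ₀ / 2 ^ ⌊(t : ℝ) / nEff M⌋₊ else γM / 2 ^ ⌊((t : ℝ) - M) / nEff N⌋₊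

/-- The distribution of the sample used in step `t + 1`: the first `M` samples come from the source,
the later ones from the target. -/
def phaseLaw (DS DT : Measure (E × ℝ)) (M t : ℕ) : Measure (E × ℝ) := if t < M then DS else DT

/-- The SGD iterates on the data stream `z 0, z 1, …`; step `t + 1` uses the sample `z t`. -/
def sgd (γ : ℕ → ℝ) (w₀ : E) (z : ℕ → E × ℝ) : ℕ → E
  | 0 => w₀
  | t + 1 => sgd γ w₀ z t -
      γ t • (outer (z t).1 (sgd γ w₀ z t) - (z t).2 • (z t).1)

/-! ### Bias and variance -/

/-- `(ℐ - γ 𝒯(γ)) ∘ A = A - γ (G A + A G - γ 𝔼[x xᵀ A x xᵀ])`, where `G = 𝔼[x xᵀ]`. -/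
def iterOp (D : Measure (E × ℝ)) (γ : ℝ) (A : E →L[ℝ] E) : E →L[ℝ] E :=
  A - γ • (covOp D * A + A * covOp D - γ • fourthOp D A)

/-- Bias iterates `B_t`. -/
def biasIter (DS DT : Measure (E × ℝ)) (M : ℕ) (γ : ℕ → ℝ) (w₀ wstar : E) : ℕ → (E →L[ℝ] E)
  | 0 => outer (w₀ - wstar)
  | t + 1 => iterOp (phaseLaw DS DT M t) (γ t) (biasIter DS DT M γ w₀ wstar t)

/-- Variance iterates `C_t`. -/
def varIter (DS DT : Measure (E × ℝ)) (M : ℕ) (γ : ℕ → ℝ) (wstar : E) : ℕ → (E →L[ℝ] E)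
  | 0 => 0
  | t + 1 => iterOp (phaseLaw DS DT M t) (γ t) (varIter DS DT M γ wstar t) +
      γ t ^ 2 • noiseOp (phaseLaw DS DT M t) wstar

/-- `½ ⟨H, B_{M+N}⟩`, where `⟨A, B⟩ = tr(A B)`. -/
def biasErr {κ : Type*} (bH : HilbertBasis κ ℝ E) (DS DT : Measure (E × ℝ)) (M N : ℕ) (γ : ℕ → ℝ)
    (w₀ wstar : E) : ℝ :=
  (1 / 2) * trace bH (covOp DT * biasIter DS DT M γ w₀ wstar (M + N))

/-- `½ ⟨H, C_{M+N}⟩`. -/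
def varErr {κ : Type*} (bH : HilbertBasis κ ℝ E) (DS DT : Measure (E × ℝ)) (M N : ℕ) (γ : ℕ → ℝ)
    (wstar : E) : ℝ :=
  (1 / 2) * trace bH (covOp DT * varIter DS DT M γ wstar (M + N))

/-! ### Effective dimensions -/

/-- `∏_{t=s}^{s+n-1} (I - γ_t A)`; the factors commute. -/
def contraction (γ : ℕ → ℝ) (A : E →L[ℝ] E) (s n : ℕ) : E →L[ℝ] E :=
  ((List.range n).map fun t => 1 - γ (s + t) • A).prod

/-- `D_eff = |K| + N_eff² γ_M² ∑_{i ∉ K} λ_i²`, with `a = N_eff γ_M`. -/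
def dEff {κ : Type*} (ev : κ → ℝ) (K : Set κ) (a : ℝ) : ℝ :=
  K.ncard + a ^ 2 * ∑' i : (Kᶜ : Set κ), ev i ^ 2

/-- `D_eff^finetune = tr(∏_{t<N} (I - γ_{M+t} H)² H (G_J⁻¹ + M_eff² γ₀² G_{Jᶜ}))`, with
`a = M_eff γ₀`. -/
def dEffFinetune {ι κ : Type*} (bG : HilbertBasis ι ℝ E) (μ : ι → ℝ) (J : Set ι)
    (bH : HilbertBasis κ ℝ E) (H : E →L[ℝ] E) (γ : ℕ → ℝ) (M N : ℕ) (a : ℝ) : ℝ :=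
  trace bH (contraction γ H M N ^ 2 * H * (specPart bG (fun i => (μ i)⁻¹) J + a ^ 2 • specPart bG μ Jᶜ))

end

end CovShift

open CovShift

/-!
Let `A_t` be the second moment of the SGD error after `t` steps, or its bias or variance part. In
the Loewner order, one step with covariance `Σ` and stepsize `γ` gives
`A_{t+1} ≥ (I - γ Σ) A_t (I - γ Σ) + γ² (β tr(Σ A_t) + ν) Σ`, where `ν` is `σ²` for the variance and
`0` for the bias. Eigendirections with eigenvalue `< 1 / (γ₀ m)`, where `m` is the effective sample
size and `γ₀` the initial stepsize of the phase, are contracted at most by a constant factor during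
the whole phase, since their relative stepsizes start below `1 / m` and decay geometrically. So
`tr(Σ A_t)` stays above a constant multiple of the tail energy of the initial error, and the phase
accumulates noise of size `1 / (m λ)` in head directions and `m γ₀² λ` in tail directions. The noise
from pretraining is then contracted by finetuning, which gives `D^ft`; the noise from finetuning
itself gives `D`.
-/

namespace CovShift

/-! ### Geometrically decaying stepsizes -/

/-- The stepsizes `g / 2^⌊t / m⌋` of a single phase, with `t` counted from the start of the
phase. -/
noncomputable def decay (m g : ℝ) (t : ℕ) : ℝ := g / 2 ^ ⌊(t : ℝ) / m⌋₊

section Decay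

variable {m g : ℝ}

lemma decay_nonneg (hg : 0 ≤ g) (t : ℕ) : 0 ≤ decay m g t := by
  unfold decay; positivity

lemma decay_le (hg : 0 ≤ g) (t : ℕ) : decay m g t ≤ g :=
  div_le_self hg (one_le_pow₀ one_le_two)

lemma decay_mul (m g a : ℝ) (t : ℕ) : decay m g t * a = decay m (g * a) t := by
  unfold decay; ring

lemma decay_eq_of_lt (hm : 0 < m) {t : ℕ} (ht : (t : ℝ) < m) : decay m g t = g := by
  rw [decay, Nat.floor_eq_zero.2 ((div_lt_one hm).2 ht), pow_zero, div_one]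

lemma decay_add_le (hm : 0 < m) (hg : 0 ≤ g) (s i : ℕ) :
    decay m g (s + i) ≤ decay m g s * (1 / 2) ^ (i / ⌈m⌉₊) := by
  have div_ceil_le : ((i / ⌈m⌉₊ : ℕ) : ℝ) ≤ i / m :=
    Nat.cast_div_le.trans (div_le_div_of_nonneg_left (by positivity) hm (Nat.le_ceil m))
  have exponent_le : ⌊(s : ℝ) / m⌋₊ + i / ⌈m⌉₊ ≤ ⌊((s + i : ℕ) : ℝ) / m⌋₊ := by
    apply Nat.le_floor
    push_cast
    rw [add_div]
    exact add_le_add (Nat.floor_le (by positivity)) div_ceil_le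
  unfold decay
  rw [one_div, inv_pow, ← div_eq_mul_inv, div_div, ← pow_add]
  exact div_le_div_of_nonneg_left hg (by positivity) (pow_le_pow_right₀ one_le_two exponent_le)

lemma sum_half_pow_div_le {p : ℕ} (hp : 0 < p) (n : ℕ) :
    ∑ i ∈ Finset.range n, (1 / 2 : ℝ) ^ (i / p) ≤ 2 * p := by
  induction n using Nat.strong_induction_on with
  | _ n ih =>
    rcases lt_or_ge n p with h | h
    · have hnp : (n : ℝ) ≤ p := by exact_mod_cast h.le
      calc ∑ i ∈ Finset.range n, (1 / 2 : ℝ) ^ (i / p) ≤ ∑ i ∈ Finset.range n, 1 :=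
            Finset.sum_le_sum fun i _ => pow_le_one₀ (by norm_num) (by norm_num)
        _ = n := by simp
        _ ≤ 2 * p := by linarith [p.cast_nonneg (α := ℝ)]
    · obtain ⟨k, rfl⟩ := Nat.exists_eq_add_of_le h
      have first_block : ∑ i ∈ Finset.range p, (1 / 2 : ℝ) ^ (i / p) = p := by
        rw [Finset.sum_congr rfl fun i hi => by
          rw [Nat.div_eq_of_lt (Finset.mem_range.1 hi), pow_zero]]
        simp
      have later_blocks : ∑ i ∈ Finset.range k, (1 / 2 : ℝ) ^ ((p + i) / p)
          = (1 / 2) * ∑ i ∈ Finset.range k, (1 / 2 : ℝ) ^ (i / p) := by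
        rw [Finset.mul_sum]
        exact Finset.sum_congr rfl fun i _ => by rw [Nat.add_div_left _ hp, pow_succ']
      rw [Finset.sum_range_add, first_block, later_blocks]
      linarith [ih k (by omega)]

lemma sum_decay_lt_inv_le (hm : 10 ≤ m) (hg : 0 ≤ g) (n : ℕ) :
    ∑ s ∈ Finset.range n with decay m g s < 1 / m, decay m g s ≤ 9 / 4 := by
  have hm0 : 0 < m := by linarith
  by_cases hex : ∃ s, decay m g s < 1 / m
  swap
  · push Not at hex
    rw [Finset.filter_false_of_mem fun s _ => not_lt.2 (hex s)]
    norm_num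
  classical
  let s₀ := Nat.find hex
  calc ∑ s ∈ Finset.range n with decay m g s < 1 / m, decay m g s
      ≤ ∑ s ∈ Finset.Ico s₀ n, decay m g s := by
        refine Finset.sum_le_sum_of_subset_of_nonneg (fun s hs => ?_) fun _ _ _ => decay_nonneg hg _
        rw [Finset.mem_filter, Finset.mem_range] at hs
        exact Finset.mem_Ico.2 ⟨Nat.find_min' hex hs.2, hs.1⟩
    _ = ∑ i ∈ Finset.range (n - s₀), decay m g (s₀ + i) := Finset.sum_Ico_eq_sum_range _ _ _
    _ ≤ ∑ i ∈ Finset.range (n - s₀), decay m g s₀ * (1 / 2) ^ (i / ⌈m⌉₊) :=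
        Finset.sum_le_sum fun i _ => decay_add_le hm0 hg s₀ i
    _ = decay m g s₀ * ∑ i ∈ Finset.range (n - s₀), (1 / 2 : ℝ) ^ (i / ⌈m⌉₊) :=
        (Finset.mul_sum _ _ _).symm
    _ ≤ 1 / m * (2 * ⌈m⌉₊) :=
        mul_le_mul (Nat.find_spec hex).le (sum_half_pow_div_le (Nat.ceil_pos.2 hm0) _)
          (by positivity) (by positivity)
    _ ≤ 9 / 4 := by
        rw [one_div, inv_mul_le_iff₀ hm0]
        linarith [Nat.ceil_lt_add_one hm0.le]

lemma exp_neg_two_mul_le_one_sub {x : ℝ} (hx : 0 ≤ x) (hx' : x ≤ 1 / 2) :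
    Real.exp (-(2 * x)) ≤ 1 - x := by
  rw [Real.exp_neg, inv_le_comm₀ (Real.exp_pos _) (by linarith)]
  refine le_trans ?_ (Real.add_one_le_exp _)
  rw [inv_le_iff_one_le_mul₀ (by linarith)]
  nlinarith

lemma exp_le_prod_one_sub_decay_sq (hm : 10 ≤ m) (hg : 0 ≤ g) (n : ℕ) :
    Real.exp (-9) ≤ ∏ s ∈ Finset.range n with decay m g s < 1 / m, (1 - decay m g s) ^ 2 := by
  calc Real.exp (-9)
      ≤ Real.exp (∑ s ∈ Finset.range n with decay m g s < 1 / m, -(4 * decay m g s)) := by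
        rw [Real.exp_le_exp, Finset.sum_neg_distrib, ← Finset.mul_sum]
        linarith [sum_decay_lt_inv_le hm hg n]
    _ = ∏ s ∈ Finset.range n with decay m g s < 1 / m, Real.exp (-(4 * decay m g s)) :=
        Real.exp_sum _ _
    _ ≤ _ := by
        refine Finset.prod_le_prod (fun _ _ => (Real.exp_pos _).le) fun s hs => ?_
        have hs_lt : decay m g s < 1 / m := (Finset.mem_filter.1 hs).2
        have hm_inv : 1 / m ≤ 1 / 10 := one_div_le_one_div_of_le (by norm_num) hm
        rw [show -(4 * decay m g s) = (2 : ℕ) * (-(2 * decay m g s)) by push_cast; ring,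
          Real.exp_nat_mul]
        exact pow_le_pow_left₀ (Real.exp_pos _).le
          (exp_neg_two_mul_le_one_sub (decay_nonneg hg s) (by linarith)) 2

lemma exp_le_prod_one_sub_decay_sq_of_lt (hm : 10 ≤ m) (hg : 0 ≤ g) (hgm : g < 1 / m) (n : ℕ) :
    Real.exp (-9) ≤ (∏ s ∈ Finset.range n, (1 - decay m g s)) ^ 2 := by
  have h := exp_le_prod_one_sub_decay_sq hm hg n
  rwa [Finset.filter_true_of_mem fun s _ => (decay_le hg s).trans_lt hgm, Finset.prod_pow] at h

end Decay

/-! ### Noise accumulated along one eigendirection -/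

/-- The noise accumulated in an eigendirection with eigenvalue `a` by SGD with stepsizes `γ`: each
step contracts what is there by `(1 - γ_t a)²` and adds fresh noise `γ_t² a`. -/
noncomputable def accum (γ : ℕ → ℝ) (a : ℝ) : ℕ → ℝ
  | 0 => 0
  | t + 1 => (1 - γ t * a) ^ 2 * accum γ a t + γ t ^ 2 * a

lemma accum_nonneg (γ : ℕ → ℝ) {a : ℝ} (ha : 0 ≤ a) (n : ℕ) : 0 ≤ accum γ a n := by
  induction n with
  | zero => exact le_rfl
  | succ n ih => rw [accum]; positivity

lemma mul_accum (γ : ℕ → ℝ) (a : ℝ) (n : ℕ) :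
    a * accum γ a n = accum (fun t => γ t * a) 1 n := by
  induction n with
  | zero => exact mul_zero a
  | succ n ih => simp only [accum, ← ih]; ring

-- The stationary level of a step of size `x` is about `x / 2`: below `x / 4` the noise still grows.
lemma min_add_le_accum_step {x y : ℝ} (hx : 0 ≤ x) (hy : 0 ≤ y) :
    min (x / 4) y + x ^ 2 / 2 ≤ (1 - x) ^ 2 * y + x ^ 2 := by
  rcases le_total (x / 4) y with h | h
  · rw [min_eq_left h]
    nlinarith [mul_le_mul_of_nonneg_left h (sq_nonneg (1 - x)), pow_nonneg hx 3]
  · rw [min_eq_right h]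
    nlinarith [mul_le_mul_of_nonneg_left h hx, mul_nonneg (sq_nonneg x) hy]

lemma min_le_accum_of_const {γ : ℕ → ℝ} {x : ℝ} (hx : 0 ≤ x) {n : ℕ} (hγ : ∀ t < n, γ t = x) :
    min (x / 4) (n * (x ^ 2 / 2)) ≤ accum γ 1 n := by
  induction n with
  | zero => simp [accum]
  | succ n ih =>
    specialize ih fun t ht => hγ t (by omega)
    calc min (x / 4) ((n + 1 : ℕ) * (x ^ 2 / 2))
        ≤ min (x / 4 + x ^ 2 / 2) (n * (x ^ 2 / 2) + x ^ 2 / 2) :=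
          min_le_min (by linarith [sq_nonneg x]) (by push_cast; linarith)
      _ = min (x / 4) (n * (x ^ 2 / 2)) + x ^ 2 / 2 := min_add_add_right _ _ _
      _ ≤ min (x / 4) (accum γ 1 n) + x ^ 2 / 2 := by
          gcongr ?_ + _
          exact le_min (min_le_left _ _) ih
      _ ≤ (1 - x) ^ 2 * accum γ 1 n + x ^ 2 :=
          min_add_le_accum_step hx (accum_nonneg γ zero_le_one n)
      _ = accum γ 1 (n + 1) := by rw [accum, hγ n n.lt_succ_self, mul_one, mul_one]

-- A step of size at least `τ` cannot bring the noise below `r ≤ τ / 4`, so only the contractions of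
-- the steps smaller than `τ` matter.
lemma mul_prod_le_accum {γ : ℕ → ℝ} (hγ : ∀ t, γ t ∈ Set.Icc 0 1) {τ r : ℝ} (hr : 0 ≤ r)
    (hrτ : r ≤ τ / 4) {k n : ℕ} (hkn : k ≤ n) (hrk : r ≤ accum γ 1 k) :
    r * ∏ s ∈ Finset.range n with γ s < τ, (1 - γ s) ^ 2 ≤ accum γ 1 n := by
  have factor_le (s : ℕ) : (1 - γ s) ^ 2 ≤ 1 :=
    pow_le_one₀ (by linarith [(hγ s).2]) (by linarith [(hγ s).1])
  have mul_prod_le (n : ℕ) : r * ∏ s ∈ Finset.range n with γ s < τ, (1 - γ s) ^ 2 ≤ r :=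
    mul_le_of_le_one_right hr (Finset.prod_le_one (fun _ _ => sq_nonneg _) fun s _ => factor_le s)
  induction n, hkn using Nat.le_induction with
  | base => exact (mul_prod_le k).trans hrk
  | succ n _ ih =>
    rw [Finset.prod_filter, Finset.prod_range_succ, ← Finset.prod_filter, accum, mul_one, mul_one]
    split_ifs with hlt
    · rw [← mul_assoc, mul_comm]
      exact (mul_le_mul_of_nonneg_left ih (sq_nonneg _)).trans
        (le_add_of_nonneg_right (sq_nonneg _))
    · rw [mul_one]
      have le_quarter : r ≤ γ n / 4 := by linarith
      have le_min_accum := le_min ((mul_prod_le n).trans le_quarter) ih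
      linarith [min_add_le_accum_step (hγ n).1 (accum_nonneg γ zero_le_one n), sq_nonneg (γ n)]

lemma min_le_accum_decay_one {m x : ℝ} (hm : 10 ≤ m) (hx : 0 ≤ x) (hx1 : x ≤ 1) {n : ℕ}
    (hn : m ≤ n) :
    min (1 / m) (m * x ^ 2) * (Real.exp (-9) / 4) ≤ accum (decay m x) 1 n := by
  have hm0 : 0 < m := by linarith
  let r := min (1 / m) (m * x ^ 2) / 4
  have first_phase : r ≤ accum (decay m x) 1 ⌈m⌉₊ := by
    refine le_trans (le_min ?_ ?_) (min_le_accum_of_const hx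
      fun t ht => decay_eq_of_lt hm0 (Nat.lt_ceil.1 ht))
    · refine div_le_div_of_nonneg_right ?_ (by norm_num)
      rcases le_total (1 / m) x with h | h
      · exact (min_le_left _ _).trans h
      · rw [le_div_iff₀' hm0] at h
        refine (min_le_right _ _).trans ?_
        nlinarith
    · have hceil : m * x ^ 2 ≤ ⌈m⌉₊ * x ^ 2 :=
        mul_le_mul_of_nonneg_right (Nat.le_ceil m) (sq_nonneg x)
      have hmx : 0 ≤ m * x ^ 2 := by positivity
      simp only [r]
      linarith [min_le_right (1 / m) (m * x ^ 2)]
  calc min (1 / m) (m * x ^ 2) * (Real.exp (-9) / 4) = r * Real.exp (-9) := by ring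
    _ ≤ r * ∏ s ∈ Finset.range n with decay m x s < 1 / m, (1 - decay m x s) ^ 2 := by
        gcongr
        exact exp_le_prod_one_sub_decay_sq hm hx n
    _ ≤ accum (decay m x) 1 n :=
        mul_prod_le_accum (fun t => ⟨decay_nonneg hx t, (decay_le hx t).trans hx1⟩) (by positivity)
          (by simp only [r]; gcongr; exact min_le_left _ _) (Nat.ceil_le.2 hn) first_phase

lemma le_accum_decay {m g a : ℝ} (hm : 10 ≤ m) (hg : 0 < g) (ha : 0 ≤ a) (hga : g * a ≤ 1) {n : ℕ}
    (hn : m ≤ n) :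
    Real.exp (-9) / 4 / m * (if 1 / (g * m) ≤ a then a⁻¹ else (m * g) ^ 2 * a)
      ≤ accum (decay m g) a n := by
  have hm0 : 0 < m := by linarith
  rcases ha.eq_or_lt with rfl | ha
  · simp [accum_nonneg]
  have head_iff : 1 / (g * m) ≤ a ↔ 1 ≤ m * (g * a) := by
    rw [div_le_iff₀ (by positivity), mul_comm a, mul_assoc, mul_left_comm]
  rw [← mul_le_mul_iff_right₀ ha, mul_accum, funext (decay_mul m g a)]
  refine le_trans (le_of_eq ?_) (min_le_accum_decay_one hm (by positivity) hga hn)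
  split_ifs with head
  · rw [head_iff] at head
    rw [min_eq_left (by rw [div_le_iff₀ hm0]; nlinarith)]
    field_simp
  · rw [head_iff, not_le] at head
    have : 0 ≤ m * (g * a) := by positivity
    rw [min_eq_right (by rw [le_div_iff₀ hm0]; nlinarith)]
    field_simp

section Operators

variable {E : Type*} [NormedAddCommGroup E] [InnerProductSpace ℝ E]

/-! ### The Loewner order -/

instance : IsOrderedAddMonoid (E →L[ℝ] E) where
  add_le_add_left A B h C := by simpa [ContinuousLinearMap.le_def] using h

instance : IsOrderedModule ℝ (E →L[ℝ] E) :=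
  .of_smul_nonneg fun _ hc _ hA => by
    rw [ContinuousLinearMap.nonneg_iff_isPositive] at *
    exact hA.smul_of_nonneg hc

lemma sqNorm_nonneg {A : E →L[ℝ] E} (hA : 0 ≤ A) (x : E) : 0 ≤ sqNorm A x :=
  ((ContinuousLinearMap.nonneg_iff_isPositive A).1 hA).inner_nonneg_right x

lemma sqNorm_mono {A B : E →L[ℝ] E} (h : A ≤ B) (x : E) : sqNorm A x ≤ sqNorm B x := by
  have hBA := sqNorm_nonneg (sub_nonneg.2 h) x
  rwa [sqNorm, sub_apply, inner_sub_right, sub_nonneg] at hBA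

lemma conj_le_conj {A B T : E →L[ℝ] E} (hT : (T : E →ₗ[ℝ] E).IsSymmetric) (h : A ≤ B) :
    T * A * T ≤ T * B * T := by
  rw [ContinuousLinearMap.le_def, ContinuousLinearMap.isPositive_iff] at h ⊢
  rw [← sub_mul, ← mul_sub]
  refine ⟨fun x y => ?_, fun x => ?_⟩
  · exact (hT _ _).trans ((h.1 _ _).trans (hT _ _))
  · exact (h.2 (T x)).trans_eq (hT _ _).symm

lemma conj_nonneg {A T : E →L[ℝ] E} (hT : (T : E →ₗ[ℝ] E).IsSymmetric) (hA : 0 ≤ A) :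
    0 ≤ T * A * T := by
  simpa using conj_le_conj hT hA

lemma outer_apply (x y : E) : outer x y = ⟪x, y⟫ • x := rfl

lemma norm_outer (x : E) : ‖outer x‖ = ‖x‖ ^ 2 := by
  rw [outer, InnerProductSpace.norm_rankOne, sq]

lemma outer_nonneg (x : E) : 0 ≤ outer x :=
  (ContinuousLinearMap.nonneg_iff_isPositive _).2 (InnerProductSpace.isPositive_rankOne_self x)

lemma sqNorm_outer (x a : E) : sqNorm (outer x) a = ⟪x, a⟫ ^ 2 := by
  rw [sqNorm, outer_apply, inner_smul_right, real_inner_comm, sq]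

lemma conj_outer {T : E →L[ℝ] E} (hT : (T : E →ₗ[ℝ] E).IsSymmetric) (w : E) :
    T * outer w * T = outer (T w) := by
  ext x
  simp only [mul_apply_eq_comp, outer_apply, map_smul]
  congr 1
  exact (hT w x).symm

/-! ### Operators that are diagonal in a Hilbert basis -/

variable {ι : Type*} {b : HilbertBasis ι ℝ E} {S T : E →L[ℝ] E} {f g : ι → ℝ}

lemma inner_basis_self (b : HilbertBasis ι ℝ E) (i : ι) : ⟪b i, b i⟫ = 1 := by
  rw [real_inner_self_eq_norm_sq, b.orthonormal.norm_eq_one, one_pow]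

namespace IsEigenbasis

lemma hasSum_inner (hT : IsEigenbasis T b f) (x y : E) :
    HasSum (fun i => f i * (⟪b i, x⟫ * ⟪b i, y⟫)) ⟪T x, y⟫ := by
  rw [real_inner_comm]
  have h := ((b.hasSum_repr x).mapL T).mapL (innerSL ℝ y)
  simp only [map_smul, hT _, innerSL_apply_apply, b.repr_apply_apply, smul_eq_mul,
    real_inner_comm (b _) y] at h
  simpa only [mul_left_comm] using h

lemma isSymmetric (hT : IsEigenbasis T b f) : (T : E →ₗ[ℝ] E).IsSymmetric := fun x y => by
  refine (hT.hasSum_inner x y).unique ?_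
  rw [real_inner_comm]
  change HasSum _ ⟪T y, x⟫
  simpa only [mul_comm] using hT.hasSum_inner y x

lemma hasSum_sqNorm (hT : IsEigenbasis T b f) (x : E) :
    HasSum (fun i => f i * ⟪b i, x⟫ ^ 2) (sqNorm T x) := by
  simpa only [sq, sqNorm, real_inner_comm] using hT.hasSum_inner x x

lemma one : IsEigenbasis (1 : E →L[ℝ] E) b fun _ => 1 := fun i => (one_smul ℝ (b i)).symm

lemma zero : IsEigenbasis (0 : E →L[ℝ] E) b fun _ => 0 := fun i => (zero_smul ℝ (b i)).symm

lemma add (hS : IsEigenbasis S b f) (hT : IsEigenbasis T b g) :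
    IsEigenbasis (S + T) b fun i => f i + g i := fun i => by
  rw [add_apply, hS i, hT i, add_smul]

lemma sub (hS : IsEigenbasis S b f) (hT : IsEigenbasis T b g) :
    IsEigenbasis (S - T) b fun i => f i - g i := fun i => by
  rw [sub_apply, hS i, hT i, sub_smul]

lemma smul (c : ℝ) (hT : IsEigenbasis T b f) : IsEigenbasis (c • T) b fun i => c * f i :=
  fun i => by rw [smul_apply, hT i, mul_smul]

lemma mul (hS : IsEigenbasis S b f) (hT : IsEigenbasis T b g) :
    IsEigenbasis (S * T) b fun i => f i * g i := fun i => by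
  rw [mul_apply_eq_comp, hT i, map_smul, hS i, smul_smul, mul_comm]

lemma one_sub_smul (c : ℝ) (hT : IsEigenbasis T b f) :
    IsEigenbasis (1 - c • T) b fun i => 1 - c * f i :=
  one.sub (hT.smul c)

lemma contraction (hT : IsEigenbasis T b f) (γ : ℕ → ℝ) (s n : ℕ) :
    IsEigenbasis (contraction γ T s n) b fun i => ∏ t ∈ Finset.range n, (1 - γ (s + t) * f i) := by
  induction n with
  | zero => exact one
  | succ n ih =>
    simpa [CovShift.contraction, List.range_succ, Finset.prod_range_succ]
      using ih.mul (hT.one_sub_smul (γ (s + n)))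

lemma nonneg (hT : IsEigenbasis T b f) (hf : ∀ i, 0 ≤ f i) : 0 ≤ T := by
  rw [ContinuousLinearMap.nonneg_iff_isPositive, ContinuousLinearMap.isPositive_iff]
  exact ⟨hT.isSymmetric, fun x => (hT.hasSum_inner x x).nonneg fun i =>
    mul_nonneg (hf i) (mul_self_nonneg _)⟩

lemma le (hS : IsEigenbasis S b f) (hT : IsEigenbasis T b g) (h : ∀ i, f i ≤ g i) : S ≤ T :=
  sub_nonneg.1 ((hT.sub hS).nonneg fun i => sub_nonneg.2 (h i))

lemma eigenvalue_eq (hT : IsEigenbasis T b f) (i : ι) : f i = sqNorm T (b i) := by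
  rw [sqNorm, hT i, inner_smul_right, inner_basis_self, mul_one]

lemma eigenvalue_le_norm (hT : IsEigenbasis T b f) (i : ι) : f i ≤ ‖T‖ := by
  refine (le_abs_self (f i)).trans ?_
  simpa [hT i, norm_smul, b.orthonormal.norm_eq_one] using T.le_opNorm (b i)

end IsEigenbasis

lemma contraction_congr {γ γ' : ℕ → ℝ} {s s' n : ℕ} (h : ∀ t < n, γ (s + t) = γ' (s' + t))
    (A : E →L[ℝ] E) : contraction γ A s n = contraction γ' A s' n := by
  unfold contraction
  congr 1
  exact List.map_congr_left fun t ht => by rw [h t (List.mem_range.1 ht)]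

lemma contraction_succ (γ : ℕ → ℝ) (A : E →L[ℝ] E) (s n : ℕ) :
    contraction γ A s (n + 1) = contraction γ A s n * (1 - γ (s + n) • A) := by
  simp [contraction, List.range_succ]

lemma contraction_succ' (γ : ℕ → ℝ) (A : E →L[ℝ] E) (s n : ℕ) :
    contraction γ A s (n + 1) = (1 - γ (s + n) • A) * contraction γ A s n := by
  rw [contraction_succ]
  refine Commute.list_prod_left _ _ fun F hF => ?_
  obtain ⟨t, -, rfl⟩ := List.mem_map.1 hF
  exact (Commute.one_left _).sub_left
    ((Commute.one_right _).sub_right (((Commute.refl A).smul_left _).smul_right _))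

lemma summable_smul_outer [CompleteSpace E] (b : HilbertBasis ι ℝ E) {U : Set ι}
    (hf : Summable fun i : U => f i) : Summable fun i : U => f i • outer (b i) :=
  Summable.of_norm <| by
    simpa [norm_smul, norm_outer, b.orthonormal.norm_eq_one] using hf.abs

lemma isEigenbasis_specPart [CompleteSpace E] (b : HilbertBasis ι ℝ E) {U : Set ι}
    (hf : Summable fun i : U => f i) : IsEigenbasis (specPart b f U) b (U.indicator f) := by
  classical
  intro j
  refine ((summable_smul_outer b hf).hasSum.mapL (ContinuousLinearMap.apply ℝ E (b j))).unique ?_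
  have term_eq (i : U) : ContinuousLinearMap.apply ℝ E (b j) (f i • outer (b i))
      = if (i : ι) = j then U.indicator f j • b j else 0 := by
    rw [ContinuousLinearMap.apply_apply, smul_apply, outer_apply,
      orthonormal_iff_ite.1 b.orthonormal]
    split_ifs with hij
    · subst hij
      rw [Set.indicator_of_mem i.2, one_smul]
    · rw [zero_smul, smul_zero]
  simp only [term_eq]
  by_cases hj : j ∈ U
  · simpa using hasSum_single (⟨j, hj⟩ : U) fun i hi => if_neg fun h => hi (Subtype.ext h)
  · rw [Set.indicator_of_notMem hj, zero_smul]
    simp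

/-! ### Trace class operators and effective dimensions -/

/-- `T` is a positive trace class operator, diagonal in the orthonormal basis `b` with eigenvalues
`f`; this is the form in which covariance operators enter the argument. -/
structure IsPosTraceClass (T : E →L[ℝ] E) (b : HilbertBasis ι ℝ E) (f : ι → ℝ) : Prop where
  isEigenbasis : IsEigenbasis T b f
  eigenvalue_nonneg : ∀ i, 0 ≤ f i
  summable : Summable f

/-- The continuous linear functional `A ↦ ∑ i, f i ⟪b i, A (b i)⟫`, which is `A ↦ tr(T A)` for the
operator `T` with eigenvalues `f` in the basis `b`. -/
noncomputable def weightedTrace (b : HilbertBasis ι ℝ E) (f : ι → ℝ) : (E →L[ℝ] E) →L[ℝ] ℝ :=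
  ∑' i, f i • (innerSL ℝ (b i)).comp (ContinuousLinearMap.apply ℝ E (b i))

lemma hasSum_weightedTrace (b : HilbertBasis ι ℝ E) (hf : Summable f) (A : E →L[ℝ] E) :
    HasSum (fun i => f i * sqNorm A (b i)) (weightedTrace b f A) := by
  have bound (i : ι) : ‖f i • (innerSL ℝ (b i)).comp (ContinuousLinearMap.apply ℝ E (b i))‖
      ≤ |f i| := by
    refine ContinuousLinearMap.opNorm_le_bound _ (abs_nonneg _) fun B => ?_
    have hB := B.le_opNorm (b i)
    have hinner := norm_inner_le_norm (𝕜 := ℝ) (b i) (B (b i))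
    rw [b.orthonormal.norm_eq_one] at hB hinner
    refine (norm_mul_le _ _).trans (mul_le_mul_of_nonneg_left ?_ (abs_nonneg _))
    exact hinner.trans (by linarith)
  exact (Summable.of_norm_bounded hf.abs bound).hasSum.mapL
    (ContinuousLinearMap.apply ℝ ℝ A)

namespace IsEigenbasis

lemma trace_mul_eq_tsum (hT : IsEigenbasis T b f) (A : E →L[ℝ] E) :
    trace b (T * A) = ∑' i, f i * sqNorm A (b i) :=
  tsum_congr fun i => by
    rw [mul_apply_eq_comp, sqNorm, ← real_inner_smul_left, ← hT i]
    exact (hT.isSymmetric _ _).symm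

lemma trace_mul_conj (hT : IsEigenbasis T b f) (hS : IsEigenbasis S b g) (A : E →L[ℝ] E) :
    trace b (T * (S * A * S)) = trace b (S ^ 2 * T * A) := by
  rw [sq, hT.trace_mul_eq_tsum, ((hS.mul hS).mul hT).trace_mul_eq_tsum]
  refine tsum_congr fun i => ?_
  have : sqNorm (S * A * S) (b i) = g i ^ 2 * sqNorm A (b i) := by
    simp only [sqNorm, mul_apply_eq_comp]
    rw [← ContinuousLinearMap.coe_coe S, ← hS.isSymmetric, ContinuousLinearMap.coe_coe, hS i,
      map_smul, real_inner_smul_left, real_inner_smul_right]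
    ring
  rw [this]
  ring

end IsEigenbasis

lemma finite_setOf_le (hf : Summable f) {r : ℝ} (hr : 0 < r) : {i | r ≤ f i}.Finite := by
  simpa [Filter.eventually_cofinite] using hf.tendsto_cofinite_zero.eventually_lt_const hr

/-- The operator `T_U⁻¹ + a² T_{Uᶜ}` for the operator `T` with eigenvalues `f` in the basis `b`. It
measures the noise left by one phase of SGD; `D_eff` and `D_eff^finetune` are traces against it. -/
noncomputable def rateOp (b : HilbertBasis ι ℝ E) (f : ι → ℝ) (U : Set ι) (a : ℝ) : E →L[ℝ] E :=
  specPart b (fun i => (f i)⁻¹) U + a ^ 2 • specPart b f Uᶜ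

lemma isEigenbasis_rateOp [CompleteSpace E] (b : HilbertBasis ι ℝ E) (hf : Summable f) {r : ℝ}
    (hr : 0 < r) (a : ℝ) [DecidablePred fun i => r ≤ f i] :
    IsEigenbasis (rateOp b f {i | r ≤ f i} a) b
      fun i => if r ≤ f i then (f i)⁻¹ else a ^ 2 * f i := by
  have := (finite_setOf_le hf hr).to_subtype
  have head := isEigenbasis_specPart b (f := fun i => (f i)⁻¹) (U := {i | r ≤ f i})
    (summable_of_hasFiniteSupport (Set.toFinite _))
  have tail := isEigenbasis_specPart b (U := {i | r ≤ f i}ᶜ) (hf.subtype _)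
  intro i
  have h := head.add (tail.smul (a ^ 2)) i
  by_cases hi : r ≤ f i <;> simpa [rateOp, hi] using h

namespace IsPosTraceClass

lemma trace_mul_eq (hT : IsPosTraceClass T b f) (A : E →L[ℝ] E) :
    trace b (T * A) = weightedTrace b f A := by
  rw [hT.isEigenbasis.trace_mul_eq_tsum, (hasSum_weightedTrace b hT.summable A).tsum_eq]

lemma trace_mul_mono (hT : IsPosTraceClass T b f) {A B : E →L[ℝ] E} (h : A ≤ B) :
    trace b (T * A) ≤ trace b (T * B) := by
  rw [hT.trace_mul_eq, hT.trace_mul_eq]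
  exact hasSum_le (fun i => mul_le_mul_of_nonneg_left (sqNorm_mono h _) (hT.eigenvalue_nonneg i))
    (hasSum_weightedTrace b hT.summable A) (hasSum_weightedTrace b hT.summable B)

lemma trace_mul_add (hT : IsPosTraceClass T b f) (A B : E →L[ℝ] E) :
    trace b (T * (A + B)) = trace b (T * A) + trace b (T * B) := by
  simp only [hT.trace_mul_eq, map_add]

lemma trace_mul_smul (hT : IsPosTraceClass T b f) (c : ℝ) (A : E →L[ℝ] E) :
    trace b (T * c • A) = c * trace b (T * A) := by
  simp only [hT.trace_mul_eq, map_smul, smul_eq_mul]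

lemma trace_mul_outer (hT : IsPosTraceClass T b f) (w : E) :
    trace b (T * outer w) = sqNorm T w := by
  rw [hT.isEigenbasis.trace_mul_eq_tsum, ← (hT.isEigenbasis.hasSum_sqNorm w).tsum_eq]
  exact tsum_congr fun i => by rw [sqNorm_outer, real_inner_comm]

lemma nonneg (hT : IsPosTraceClass T b f) : 0 ≤ T := hT.isEigenbasis.nonneg hT.eigenvalue_nonneg

variable [CompleteSpace E]

lemma isEigenbasis_specPart (hT : IsPosTraceClass T b f) (U : Set ι) :
    IsEigenbasis (specPart b f U) b (U.indicator f) :=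
  CovShift.isEigenbasis_specPart b (hT.summable.subtype U)

lemma specPart_nonneg (hT : IsPosTraceClass T b f) (U : Set ι) : 0 ≤ specPart b f U :=
  (hT.isEigenbasis_specPart U).nonneg fun i =>
    Set.indicator_nonneg (fun j _ => hT.eigenvalue_nonneg j) i

lemma rateOp_nonneg (hT : IsPosTraceClass T b f) {r : ℝ} (hr : 0 < r) (a : ℝ) :
    0 ≤ rateOp b f {i | r ≤ f i} a := by
  classical
  refine (isEigenbasis_rateOp b hT.summable hr a).nonneg fun i => ?_
  have := hT.eigenvalue_nonneg i
  split_ifs <;> positivity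

lemma trace_mul_rateOp (hT : IsPosTraceClass T b f) {r : ℝ} (hr : 0 < r) (a : ℝ) :
    trace b (T * rateOp b f {i | r ≤ f i} a) = dEff f {i | r ≤ f i} a := by
  classical
  have := (finite_setOf_le hT.summable hr).fintype
  let U : Set ι := {i | r ≤ f i}
  have rate := isEigenbasis_rateOp b hT.summable hr a
  have hsum := (hasSum_weightedTrace b hT.summable (rateOp b f U a)).summable
  rw [hT.isEigenbasis.trace_mul_eq_tsum, ← hsum.tsum_subtype_add_tsum_subtype_compl U, dEff,
    ← tsum_mul_left]
  congr 1
  · have head (i : U) : f i * sqNorm (rateOp b f U a) (b i) = 1 := by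
      have hi : r ≤ f i := i.2
      rw [← rate.eigenvalue_eq, if_pos hi, mul_inv_cancel₀ (by linarith)]
    simp only [head, tsum_fintype, Finset.sum_const, nsmul_eq_mul, mul_one, Finset.card_univ,
      Set.ncard_eq_toFinset_card', U, Set.toFinset_card]
  · refine tsum_congr fun i => ?_
    rw [← rate.eigenvalue_eq, if_neg (show ¬ r ≤ f i from i.2)]
    ring

end IsPosTraceClass

end Operators

section Dynamics

variable {E : Type*} [NormedAddCommGroup E] [InnerProductSpace ℝ E] {ι : Type*}
  {b : HilbertBasis ι ℝ E} {T : E →L[ℝ] E} {f : ι → ℝ}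

/-! ### One phase of SGD in the Loewner order -/

/-- The noise operator accumulated by SGD with stepsizes `γ`, covariance `T` and unit noise; it acts
on eigenvectors of `T` through `accum`. -/
noncomputable def accumOp (γ : ℕ → ℝ) (T : E →L[ℝ] E) : ℕ → (E →L[ℝ] E)
  | 0 => 0
  | t + 1 => (1 - γ t • T) * accumOp γ T t * (1 - γ t • T) + γ t ^ 2 • T

lemma isEigenbasis_accumOp (hT : IsEigenbasis T b f) (γ : ℕ → ℝ) (n : ℕ) :
    IsEigenbasis (accumOp γ T n) b fun i => accum γ (f i) n := by
  induction n with
  | zero => exact .zero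
  | succ n ih =>
    have hstep := hT.one_sub_smul (γ n)
    refine fun i => (((hstep.mul ih).mul hstep).add (hT.smul (γ n ^ 2)) i).trans ?_
    simp only [accum]
    ring_nf

lemma contraction_conj_add_accumOp_succ (γ : ℕ → ℝ) (T B : E →L[ℝ] E) (c : ℝ) (n : ℕ) :
    contraction γ T 0 (n + 1) * B * contraction γ T 0 (n + 1) + c • accumOp γ T (n + 1)
      = (1 - γ n • T) * (contraction γ T 0 n * B * contraction γ T 0 n + c • accumOp γ T n)
          * (1 - γ n • T) + (γ n ^ 2 * c) • T :=
  calc _ = (1 - γ n • T) * contraction γ T 0 n * B * (contraction γ T 0 n * (1 - γ n • T))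
          + c • accumOp γ T (n + 1) := by
        nth_rw 1 [contraction_succ']
        rw [contraction_succ, zero_add]
    _ = _ := by
        rw [accumOp, smul_add, smul_smul, mul_add, add_mul, mul_smul_comm, smul_mul_assoc,
          mul_comm c (γ n ^ 2)]
        noncomm_ring

/-- One step `A ↦ A'` of the second moment of SGD with covariance `T` and stepsize `γ` contracts by
`1 - γ T` on both sides and adds at least the noise `γ² (β tr(T A) + ν) T`: `β tr(T A)` comes from
the fourth moment of the covariates and `ν` from the label noise. -/
def IsLowerStep (b : HilbertBasis ι ℝ E) (T : E →L[ℝ] E) (β ν γ : ℝ) (A A' : E →L[ℝ] E) : Prop :=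
  (1 - γ • T) * A * (1 - γ • T) + (γ ^ 2 * (β * trace b (T * A) + ν)) • T ≤ A'

namespace IsPosTraceClass

lemma accumOp_nonneg (hT : IsPosTraceClass T b f) (γ : ℕ → ℝ) (n : ℕ) : 0 ≤ accumOp γ T n :=
  (isEigenbasis_accumOp hT.isEigenbasis γ n).nonneg fun i =>
    accum_nonneg γ (hT.eigenvalue_nonneg i) n

lemma isLowerStep_mono (hT : IsPosTraceClass T b f) {β ν e γ : ℝ} (hβ : 0 ≤ β) {A B A' : E →L[ℝ] E}
    (hAB : A ≤ B) (he : e ≤ trace b (T * B)) (h : IsLowerStep b T β ν γ B A') :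
    (1 - γ • T) * A * (1 - γ • T) + (γ ^ 2 * (β * e + ν)) • T ≤ A' :=
  (add_le_add (conj_le_conj (hT.isEigenbasis.one_sub_smul γ).isSymmetric hAB)
    (smul_le_smul_of_nonneg_right (by gcongr) hT.nonneg)).trans h

lemma le_of_isLowerStep (hT : IsPosTraceClass T b f) {γ : ℕ → ℝ} {β ν e : ℝ} (hβ : 0 ≤ β)
    (hν : 0 ≤ ν) (he : 0 ≤ e) {A : ℕ → E →L[ℝ] E} {w : E} (hw : outer w ≤ A 0) {n : ℕ}
    (energy_ge : ∀ t < n, e ≤ sqNorm T (contraction γ T 0 t w))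
    (step : ∀ t < n, 0 ≤ A t → IsLowerStep b T β ν (γ t) (A t) (A (t + 1))) :
    contraction γ T 0 n * A 0 * contraction γ T 0 n + (β * e + ν) • accumOp γ T n ≤ A n := by
  induction n with
  | zero => simp [contraction, accumOp]
  | succ n ih =>
    specialize ih (fun t ht => energy_ge t (by omega)) fun t ht => step t (by omega)
    have symm := (hT.isEigenbasis.contraction γ 0 n).isSymmetric
    have outer_le : outer (contraction γ T 0 n w) ≤ A n :=
      calc outer (contraction γ T 0 n w)
          ≤ contraction γ T 0 n * A 0 * contraction γ T 0 n :=
            (conj_outer symm w).symm.trans_le (conj_le_conj symm hw)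
        _ ≤ A n := (le_add_of_nonneg_right
            (smul_nonneg (by positivity) (hT.accumOp_nonneg γ n))).trans ih
    have e_le : e ≤ trace b (T * A n) :=
      (energy_ge n n.lt_succ_self).trans
        ((hT.trace_mul_outer _).symm.trans_le (hT.trace_mul_mono outer_le))
    rw [contraction_conj_add_accumOp_succ]
    exact hT.isLowerStep_mono hβ ih e_le (step n n.lt_succ_self ((outer_nonneg _).trans outer_le))

variable [CompleteSpace E] {m g : ℝ}

-- Tail directions are those in which all relative stepsizes `γ_t λ` are below `1 / m`, so a whole
-- phase contracts them by at most a constant factor.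
lemma exp_mul_specPart_le_sqNorm_contraction (hT : IsPosTraceClass T b f) (hm : 10 ≤ m) (hg : 0 < g)
    (n : ℕ) (w : E) :
    Real.exp (-9) * sqNorm (specPart b f {i | 1 / (g * m) ≤ f i}ᶜ) w
      ≤ sqNorm T (contraction (decay m g) T 0 n w) := by
  have hm0 : 0 < m := by linarith
  have hC := hT.isEigenbasis.contraction (decay m g) 0 n
  have tail_le : Real.exp (-9) • specPart b f {i | 1 / (g * m) ≤ f i}ᶜ
      ≤ contraction (decay m g) T 0 n * T * contraction (decay m g) T 0 n := by
    refine ((hT.isEigenbasis_specPart _).smul _).le ((hC.mul hT.isEigenbasis).mul hC) fun i => ?_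
    simp only [zero_add, decay_mul]
    rw [mul_right_comm, ← sq]
    have hf := hT.eigenvalue_nonneg i
    by_cases hi : 1 / (g * m) ≤ f i
    · rw [Set.indicator_of_notMem (by simpa using hi), mul_zero]
      positivity
    · rw [Set.indicator_of_mem hi]
      have hgf : g * f i < 1 / m := by
        rw [not_le, lt_div_iff₀ (by positivity)] at hi
        rw [lt_div_iff₀ hm0]
        linarith
      gcongr
      exact exp_le_prod_one_sub_decay_sq_of_lt hm (by positivity) hgf n
  calc Real.exp (-9) * sqNorm (specPart b f {i | 1 / (g * m) ≤ f i}ᶜ) w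
      = sqNorm (Real.exp (-9) • specPart b f {i | 1 / (g * m) ≤ f i}ᶜ) w := by
        rw [sqNorm, sqNorm, smul_apply, inner_smul_right]
    _ ≤ _ := sqNorm_mono tail_le w
    _ = sqNorm T (contraction (decay m g) T 0 n w) := (hC.isSymmetric _ _).symm

lemma rateOp_le_accumOp (hT : IsPosTraceClass T b f) (hm : 10 ≤ m) (hg : 0 < g)
    (hgT : g * ‖T‖ ≤ 1) {n : ℕ} (hn : m ≤ n) :
    (Real.exp (-9) / 4 / m) • rateOp b f {i | 1 / (g * m) ≤ f i} (m * g)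
      ≤ accumOp (decay m g) T n := by
  classical
  have hr : 0 < 1 / (g * m) := by positivity
  refine ((isEigenbasis_rateOp b hT.summable hr _).smul _).le
    (isEigenbasis_accumOp hT.isEigenbasis _ n) fun i => ?_
  exact le_accum_decay hm hg (hT.eigenvalue_nonneg i)
    ((mul_le_mul_of_nonneg_left (hT.isEigenbasis.eigenvalue_le_norm i) hg.le).trans hgT) hn

lemma phase_ge (hT : IsPosTraceClass T b f) (hm : 10 ≤ m) (hg : 0 < g) (hgT : g * ‖T‖ ≤ 1) {n : ℕ}
    (hn : m ≤ n) {β ν : ℝ} (hβ : 0 ≤ β) (hν : 0 ≤ ν) {A : ℕ → E →L[ℝ] E} {w : E}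
    (hw : outer w ≤ A 0)
    (step : ∀ t < n, 0 ≤ A t → IsLowerStep b T β ν (decay m g t) (A t) (A (t + 1))) :
    contraction (decay m g) T 0 n * A 0 * contraction (decay m g) T 0 n
      + (Real.exp (-18) / 4 / m * (β * sqNorm (specPart b f {i | 1 / (g * m) ≤ f i}ᶜ) w + ν))
        • rateOp b f {i | 1 / (g * m) ≤ f i} (m * g) ≤ A n := by
  have : 0 < m := by linarith
  set q := sqNorm (specPart b f {i | 1 / (g * m) ≤ f i}ᶜ) w
  have hq0 : 0 ≤ q := sqNorm_nonneg (hT.specPart_nonneg _) w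
  refine le_trans (add_le_add_right ?_ _) (hT.le_of_isLowerStep hβ hν
    (mul_nonneg (Real.exp_nonneg (-9)) hq0) hw
    (fun t _ => hT.exp_mul_specPart_le_sqNorm_contraction hm hg t w) step)
  have exp_le : Real.exp (-9) * (β * q + ν) ≤ β * (Real.exp (-9) * q) + ν := by
    have : Real.exp (-9) * ν ≤ ν := mul_le_of_le_one_left hν (Real.exp_le_one_iff.2 (by norm_num))
    linarith
  calc (Real.exp (-18) / 4 / m * (β * q + ν)) • rateOp b f {i | 1 / (g * m) ≤ f i} (m * g)
      = (Real.exp (-9) * (β * q + ν)) • (Real.exp (-9) / 4 / m)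
          • rateOp b f {i | 1 / (g * m) ≤ f i} (m * g) := by
        rw [smul_smul, show (-18 : ℝ) = -9 + -9 by norm_num, Real.exp_add]
        congr 1
        ring
    _ ≤ (Real.exp (-9) * (β * q + ν)) • accumOp (decay m g) T n :=
        smul_le_smul_of_nonneg_left (hT.rateOp_le_accumOp hm hg hgT hn) (by positivity)
    _ ≤ (β * (Real.exp (-9) * q) + ν) • accumOp (decay m g) T n :=
        smul_le_smul_of_nonneg_right exp_le (hT.accumOp_nonneg _ n)

end IsPosTraceClass

end Dynamics

/-! ### Pretraining followed by finetuning -/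

lemma le_of_ten_le_nEff {n : ℕ} (h : 10 ≤ nEff n) : nEff n ≤ n := by
  have hn : 3 ≤ n := by
    by_contra! hn
    interval_cases n
    · norm_num [nEff] at h
    · norm_num [nEff] at h
    · have := Real.log_two_gt_d9
      rw [nEff, Nat.cast_ofNat, le_div_iff₀ (by linarith)] at h
      linarith
  refine div_le_self n.cast_nonneg ?_
  rw [Real.le_log_iff_exp_le (by positivity)]
  have : (3 : ℝ) ≤ n := by exact_mod_cast hn
  linarith [Real.exp_one_lt_d9]

lemma stepsize_of_lt {M t : ℕ} (N : ℕ) (γ₀ γM : ℝ) (h : t < M) :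
    stepsize M N γ₀ γM t = decay (nEff M) γ₀ t := if_pos h

lemma stepsize_add (M N : ℕ) (γ₀ γM : ℝ) (t : ℕ) :
    stepsize M N γ₀ γM (M + t) = decay (nEff N) γM t := by
  rw [stepsize, if_neg (by omega), decay]
  push_cast
  rw [add_sub_cancel_left]

lemma dEff_nonneg {κ : Type*} (ev : κ → ℝ) (K : Set κ) (a : ℝ) : 0 ≤ dEff ev K a := by
  have : 0 ≤ ∑' i : (Kᶜ : Set κ), ev i ^ 2 := tsum_nonneg fun i => sq_nonneg _
  unfold dEff
  positivity

section TwoPhase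

variable {E : Type*} [NormedAddCommGroup E] [InnerProductSpace ℝ E] [CompleteSpace E]
  {ι κ : Type*} {bG : HilbertBasis ι ℝ E} {bH : HilbertBasis κ ℝ E} {G H : E →L[ℝ] E}
  {μ : ι → ℝ} {ev : κ → ℝ} {M N : ℕ} {γ₀ γM β ν : ℝ} {A : ℕ → E →L[ℝ] E}

lemma dEffFinetune_nonneg (hG : IsPosTraceClass G bG μ) (hH : IsPosTraceClass H bH ev)
    {r : ℝ} (hr : 0 < r) (γ : ℕ → ℝ) (M N : ℕ) (a : ℝ) :
    0 ≤ dEffFinetune bG μ {j | r ≤ μ j} bH H γ M N a := by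
  have hC := hH.isEigenbasis.contraction γ M N
  have h := hH.trace_mul_mono (conj_nonneg hC.isSymmetric (hG.rateOp_nonneg hr a))
  rw [hH.isEigenbasis.trace_mul_conj hC] at h
  have trace_zero : trace bH (H * 0) = 0 := by simp [trace]
  exact trace_zero.symm.trans_le h

lemma pretraining_ge (hG : IsPosTraceClass G bG μ) (hM : 10 ≤ nEff M) (hγ₀ : 0 < γ₀)
    (hγG : γ₀ * ‖G‖ ≤ 1) (hβ : 0 ≤ β) (hν : 0 ≤ ν) {w : E} (hw : outer w ≤ A 0)
    (step : ∀ t < M, 0 ≤ A t → IsLowerStep bG G β ν (stepsize M N γ₀ γM t) (A t) (A (t + 1))) :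
    outer (contraction (stepsize M N γ₀ γM) G 0 M w)
      + (Real.exp (-18) / 4 / nEff M
          * (β * sqNorm (specPart bG μ {j | 1 / (γ₀ * nEff M) ≤ μ j}ᶜ) w + ν))
        • rateOp bG μ {j | 1 / (γ₀ * nEff M) ≤ μ j} (nEff M * γ₀) ≤ A M := by
  have contraction_eq :
      contraction (decay (nEff M) γ₀) G 0 M = contraction (stepsize M N γ₀ γM) G 0 M :=
    contraction_congr (fun t ht => by rw [zero_add, stepsize_of_lt N γ₀ γM ht]) G
  have h := hG.phase_ge hM hγ₀ hγG (le_of_ten_le_nEff hM) hβ hν hw fun t ht => by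
    rw [← stepsize_of_lt N γ₀ γM ht]
    exact step t ht
  have symm := (hG.isEigenbasis.contraction (stepsize M N γ₀ γM) 0 M).isSymmetric
  rw [contraction_eq] at h
  exact (add_le_add_left ((conj_outer symm w).symm.trans_le (conj_le_conj symm hw)) _).trans h

lemma finetuning_ge (hH : IsPosTraceClass H bH ev) (hN : 10 ≤ nEff N) (hγM : 0 < γM)
    (hγH : γM * ‖H‖ ≤ 1) (hβ : 0 ≤ β) (hν : 0 ≤ ν) {v : E} (hv : outer v ≤ A M)
    (step : ∀ t < N, 0 ≤ A (M + t) →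
      IsLowerStep bH H β ν (stepsize M N γ₀ γM (M + t)) (A (M + t)) (A (M + t + 1))) :
    contraction (stepsize M N γ₀ γM) H M N * A M * contraction (stepsize M N γ₀ γM) H M N
      + (Real.exp (-18) / 4 / nEff N
          * (β * sqNorm (specPart bH ev {k | 1 / (γM * nEff N) ≤ ev k}ᶜ) v + ν))
        • rateOp bH ev {k | 1 / (γM * nEff N) ≤ ev k} (nEff N * γM) ≤ A (M + N) := by
  have contraction_eq :
      contraction (decay (nEff N) γM) H 0 N = contraction (stepsize M N γ₀ γM) H M N :=
    contraction_congr (fun t _ => by rw [zero_add, stepsize_add]) H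
  have h := hH.phase_ge (A := fun t => A (M + t)) hN hγM hγH (le_of_ten_le_nEff hN) hβ hν hv
    fun t ht => by
      rw [← stepsize_add M N γ₀ γM]
      exact step t ht
  rwa [contraction_eq] at h

lemma two_phase_ge (hG : IsPosTraceClass G bG μ) (hH : IsPosTraceClass H bH ev)
    (hM : 10 ≤ nEff M) (hN : 10 ≤ nEff N) (hγ₀ : 0 < γ₀) (hγM : 0 < γM) (hγG : γ₀ * ‖G‖ ≤ 1)
    (hγH : γM * ‖H‖ ≤ 1) (hβ : 0 ≤ β) (hν : 0 ≤ ν) {w : E} (hw : outer w ≤ A 0)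
    (pretraining_step : ∀ t < M, 0 ≤ A t →
      IsLowerStep bG G β ν (stepsize M N γ₀ γM t) (A t) (A (t + 1)))
    (finetuning_step : ∀ t < N, 0 ≤ A (M + t) →
      IsLowerStep bH H β ν (stepsize M N γ₀ γM (M + t)) (A (M + t)) (A (M + t + 1))) :
    let γ := stepsize M N γ₀ γM
    let J : Set ι := {j | 1 / (γ₀ * nEff M) ≤ μ j}
    let K : Set κ := {k | 1 / (γM * nEff N) ≤ ev k}
    let v := contraction γ G 0 M w
    sqNorm H (contraction γ H M N v)
      + Real.exp (-18) / 4 / nEff M * (β * sqNorm (specPart bG μ Jᶜ) w + ν)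
        * dEffFinetune bG μ J bH H γ M N (nEff M * γ₀)
      + Real.exp (-18) / 4 / nEff N * (β * sqNorm (specPart bH ev Kᶜ) v + ν)
        * dEff ev K (nEff N * γM)
      ≤ trace bH (H * A (M + N)) := by
  intro γ J _ v
  have hM0 : 0 < nEff M := by linarith
  have hN0 : 0 < nEff N := by linarith
  have pretrained := pretraining_ge hG hM hγ₀ hγG hβ hν hw pretraining_step
  have tail_nonneg := sqNorm_nonneg (hG.specPart_nonneg Jᶜ) w
  have noise_nonneg := hG.rateOp_nonneg (one_div_pos.2 (mul_pos hγ₀ hM0)) (nEff M * γ₀)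
  have outer_le : outer v ≤ A M :=
    (le_add_of_nonneg_right (smul_nonneg (by positivity) noise_nonneg)).trans pretrained
  have hC := hH.isEigenbasis.contraction γ M N
  have finetuned := hH.trace_mul_mono <|
    (add_le_add_left (conj_le_conj hC.isSymmetric pretrained) _).trans
      (finetuning_ge hH hN hγM hγH hβ hν outer_le finetuning_step)
  rwa [mul_add (contraction γ H M N), add_mul (_ * _), conj_outer hC.isSymmetric, mul_smul_comm,
    smul_mul_assoc, hH.trace_mul_add, hH.trace_mul_add, hH.trace_mul_smul, hH.trace_mul_smul,
    hH.trace_mul_outer, hH.isEigenbasis.trace_mul_conj hC,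
    hH.trace_mul_rateOp (one_div_pos.2 (mul_pos hγM hN0))] at finetuned

/-! ### Comparison of the lower and upper rates -/

lemma add_le_add_rates {X Y q Q p p' α β V a : ℝ} (hX : 0 ≤ X) (hY : 0 ≤ Y)
    (hq : 0 ≤ q) (hp : 0 ≤ p) (hqQ : q ≤ Q) (hpp : p ≤ p') (hβ : 0 ≤ β) (hα : β ≤ α) :
    V + (a + β * q * X + β * p * Y) ≤ V + (a + α * Q * X + α * (p' + Q) * Y) := by
  have hα0 : 0 ≤ α := hβ.trans hα
  gcongr
  linarith

-- The variance `s (X + Y)` absorbs the terms `Q X`, `Q Y` and `p' Y`, as `Q, p' ≤ R s`.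
lemma half_mul_upper_rate_le {a X Y q Q p p' α β R s : ℝ} (ha : 0 ≤ a) (hX : 0 ≤ X) (hY : 0 ≤ Y)
    (hq : 0 ≤ q) (hp : 0 ≤ p) (hqQ : q ≤ Q) (hQ : Q ≤ R * s) (hp' : p' ≤ R * s)
    (hβ : 0 ≤ β) (hα : β ≤ α) (hs : 0 < s) :
    1 / 2 * (s * (X + Y) + (a + α * Q * X + α * (p' + Q) * Y))
      ≤ (1 + α * R) * (s * (X + Y) + (a + β * q * X + β * p * Y)) := by
  have hα0 : 0 ≤ α := hβ.trans hα
  have hR : 0 ≤ R := nonneg_of_mul_nonneg_left ((hq.trans hqQ).trans hQ) hs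
  have hαR : 0 ≤ α * R := mul_nonneg hα0 hR
  calc 1 / 2 * (s * (X + Y) + (a + α * Q * X + α * (p' + Q) * Y))
      ≤ 1 / 2 * (s * (X + Y) + (a + α * (R * s) * X + α * (R * s + R * s) * Y)) := by gcongr
    _ ≤ (1 + α * R) * (s * (X + Y) + a) := by
        nlinarith [mul_nonneg hs.le hX, mul_nonneg hs.le hY, mul_nonneg hαR ha,
          mul_nonneg hαR (mul_nonneg hs.le hX)]
    _ ≤ (1 + α * R) * (s * (X + Y) + (a + β * q * X + β * p * Y)) := by
        have : 0 ≤ β * q * X := by positivity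
        have : 0 ≤ β * p * Y := by positivity
        gcongr
        linarith

lemma isEigenbasis_headTail (hG : IsPosTraceClass G bG μ) {r : ℝ} (hr : 0 < r)
    [DecidablePred fun i => r ≤ μ i] :
    IsEigenbasis (specPart bG (fun _ => r) {i | r ≤ μ i} + specPart bG μ {i | r ≤ μ i}ᶜ) bG
      fun i => if r ≤ μ i then r else μ i := by
  have := (finite_setOf_le hG.summable hr).to_subtype
  have head := isEigenbasis_specPart bG (f := fun _ => r) (U := {i | r ≤ μ i})
    (summable_of_hasFiniteSupport (Set.toFinite _))
  intro i
  have h := head.add (hG.isEigenbasis_specPart {i | r ≤ μ i}ᶜ) i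
  by_cases hi : r ≤ μ i <;> simpa [hi] using h

lemma sqNorm_tail_le_headTail (hG : IsPosTraceClass G bG μ) {r : ℝ} (hr : 0 < r) (w : E) :
    sqNorm (specPart bG μ {i | r ≤ μ i}ᶜ) w
      ≤ sqNorm (specPart bG (fun _ => r) {i | r ≤ μ i} + specPart bG μ {i | r ≤ μ i}ᶜ) w := by
  classical
  refine sqNorm_mono ((hG.isEigenbasis_specPart _).le (isEigenbasis_headTail hG hr) fun i => ?_) w
  by_cases hi : r ≤ μ i <;> simp [hi, hr.le]

lemma sqNorm_headTail_le (hG : IsPosTraceClass G bG μ) {r : ℝ} (hr : 0 < r) (w : E) :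
    sqNorm (specPart bG (fun _ => r) {i | r ≤ μ i} + specPart bG μ {i | r ≤ μ i}ᶜ) w
      ≤ sqNorm G w := by
  classical
  refine sqNorm_mono ((isEigenbasis_headTail hG hr).le hG.isEigenbasis fun i => ?_) w
  split_ifs with hi
  exacts [hi, le_rfl]

lemma lower_rate_le_and_mul_upper_rate_le (hG : IsPosTraceClass G bG μ)
    (hH : IsPosTraceClass H bH ev) {r s : ℝ} (hr : 0 < r) (hs : 0 < s)
    {X Y a c α R V : ℝ} (hX : 0 ≤ X) (hY : 0 ≤ Y) (ha : 0 ≤ a)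
    (hβ : 0 ≤ β) (hα : β ≤ α) (hV : 0 < V) {w v : E} (hw : sqNorm G w ≤ R * V)
    (hv : sqNorm H v ≤ R * V) (hc : c ≤ 1 / 2) :
    let J : Set ι := {j | r ≤ μ j}
    let K : Set κ := {k | s ≤ ev k}
    let headTail := sqNorm (specPart bG (fun _ => r) J + specPart bG μ Jᶜ) w
    let lower := V * (X + Y) +
      (a + β * sqNorm (specPart bG μ Jᶜ) w * X + β * sqNorm (specPart bH ev Kᶜ) v * Y)
    let upper := V * (X + Y) + (a + α * headTail * X +
      α * (sqNorm (specPart bH (fun _ => s) K + specPart bH ev Kᶜ) v + headTail) * Y)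
    lower ≤ upper ∧ c * upper ≤ (1 + α * R) * lower := by
  intro J K headTail lower upper
  have tailG_nonneg := sqNorm_nonneg (hG.specPart_nonneg Jᶜ) w
  have tailH_nonneg := sqNorm_nonneg (hH.specPart_nonneg Kᶜ) v
  have tailG_le := sqNorm_tail_le_headTail hG hr w
  have tailH_le := sqNorm_tail_le_headTail hH hs v
  have lower_le : lower ≤ upper :=
    add_le_add_rates hX hY tailG_nonneg tailH_nonneg tailG_le tailH_le hβ hα
  have lower_nonneg : 0 ≤ lower := by positivity
  exact ⟨lower_le, (mul_le_mul_of_nonneg_right hc (lower_nonneg.trans lower_le)).trans <|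
    half_mul_upper_rate_le ha hX hY tailG_nonneg tailH_nonneg tailG_le
      ((sqNorm_headTail_le hG hr w).trans hw) ((sqNorm_headTail_le hH hs v).trans hv) hβ hα hV⟩

end TwoPhase

/-! ### Moments of the data distributions -/

lemma integrable_mulLeftRight {α R : Type*} [MeasurableSpace α] {ρ : Measure α} [NormedRing R]
    [NormedAlgebra ℝ R] {Q : α → R} (hQ : MemLp Q 2 ρ) :
    Integrable (fun a => ContinuousLinearMap.mulLeftRight ℝ R (Q a) (Q a)) ρ := by
  refine (hQ.integrable_norm_pow two_ne_zero).mono' ?_ (ae_of_all _ fun a => ?_)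
  · exact (ContinuousLinearMap.mulLeftRight ℝ R).aestronglyMeasurable_comp₂ hQ.1 hQ.1
  · rw [sq]
    exact ContinuousLinearMap.opNorm_mulLeftRight_apply_apply_le ..

lemma one_sub_smul_mul_mul_one_sub_smul {R : Type*} [Ring R] [Algebra ℝ R] (γ : ℝ) (Q A : R) :
    (1 - γ • Q) * A * (1 - γ • Q) = A - γ • (Q * A + A * Q - γ • (Q * A * Q)) := by
  simp only [sub_mul, mul_sub, one_mul, mul_one, smul_mul_assoc, mul_smul_comm, smul_sub, smul_add]
  abel

lemma integral_one_sub_smul_mul_mul_one_sub_smul {α R : Type*} [MeasurableSpace α] {ρ : Measure α}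
    [IsProbabilityMeasure ρ] [NormedRing R] [NormedAlgebra ℝ R] [CompleteSpace R] {X : α → R}
    (hX : MemLp X 2 ρ) (γ : ℝ) (A : R) :
    ∫ a, (1 - γ • X a) * A * (1 - γ • X a) ∂ρ =
      A - γ • ((∫ a, X a ∂ρ) * A + A * ∫ a, X a ∂ρ - γ • ∫ a, X a * A * X a ∂ρ) := by
  have integrable : Integrable X ρ := hX.integrable one_le_two
  have left : Integrable (fun a => X a * A) ρ := integrable.mul_const A
  have right : Integrable (fun a => A * X a) ρ := integrable.const_mul A
  have cross : Integrable (fun a => X a * A + A * X a) ρ := left.add right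
  have quadratic : Integrable (fun a => γ • (X a * A * X a)) ρ :=
    ((integrable_mulLeftRight hX).apply_continuousLinearMap A).smul γ
  have increment : Integrable (fun a => γ • (X a * A + A * X a - γ • (X a * A * X a))) ρ :=
    (cross.sub quadratic).smul γ
  simp only [one_sub_smul_mul_mul_one_sub_smul]
  rw [integral_sub (integrable_const A) increment, integral_smul,
    integral_sub cross quadratic, integral_smul, integral_add left right,
    integral_mul_const_of_integrable integrable, integral_const_mul_of_integrable integrable,
    integral_const, probReal_univ, one_smul]

section Moments

variable {E : Type*} [NormedAddCommGroup E] [InnerProductSpace ℝ E]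

lemma continuous_outer : Continuous (outer : E → E →L[ℝ] E) := by
  change Continuous fun x : E => InnerProductSpace.rankOne ℝ x x
  simp only [InnerProductSpace.rankOne_def]
  fun_prop

section

variable {α : Type*} [MeasurableSpace α] {ρ : Measure α} {X : α → E}

lemma integrable_outer (hX : MemLp X 2 ρ) : Integrable (fun a => outer (X a)) ρ := by
  refine (hX.integrable_norm_pow two_ne_zero).mono' ?_ (ae_of_all _ fun a => (norm_outer _).le)
  exact continuous_outer.comp_aestronglyMeasurable hX.1

lemma memLp_outer (hX : MemLp X 4 ρ) : MemLp (fun a => outer (X a)) 2 ρ := by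
  rw [memLp_two_iff_integrable_sq_norm (continuous_outer.comp_aestronglyMeasurable hX.1)]
  simpa only [norm_outer, ← pow_mul] using hX.integrable_norm_pow four_ne_zero

lemma memLp_one_sub_smul_outer [IsFiniteMeasure ρ] (hX : MemLp X 4 ρ) (γ : ℝ) :
    MemLp (fun a => 1 - γ • outer (X a)) 2 ρ :=
  (memLp_const 1).sub ((memLp_outer hX).const_smul γ)

lemma sqNorm_integral [CompleteSpace E] {F : α → E →L[ℝ] E} (hF : Integrable F ρ) (a : E) :
    sqNorm (∫ z, F z ∂ρ) a = ∫ z, sqNorm (F z) a ∂ρ :=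
  (((innerSL ℝ a).comp (ContinuousLinearMap.apply ℝ E a)).integral_comp_comm hF).symm

lemma IsPosTraceClass.integrable_sqNorm [CompleteSpace E] {ι : Type*} {T : E →L[ℝ] E}
    {b : HilbertBasis ι ℝ E} {f : ι → ℝ} (hT : IsPosTraceClass T b f) (hX : MemLp X 2 ρ) :
    Integrable (fun a => sqNorm T (X a)) ρ ∧
      ∫ a, sqNorm T (X a) ∂ρ = trace b (T * ∫ a, outer (X a) ∂ρ) := by
  have outer_integrable := integrable_outer hX
  simp only [← hT.trace_mul_outer, hT.trace_mul_eq]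
  exact ⟨(weightedTrace b f).integrable_comp outer_integrable,
    (weightedTrace b f).integral_comp_comm outer_integrable⟩

end

variable [MeasurableSpace E] {D : Measure (E × ℝ)}

lemma FourthMomentLower.memLp [SecondCountableTopology E] [BorelSpace E] {ι : Type*}
    {b : HilbertBasis ι ℝ E} {β : ℝ} (h : FourthMomentLower D b β) : MemLp Prod.fst 4 D := by
  rw [← integrable_norm_rpow_iff (by fun_prop) (by norm_num) (by norm_num)]
  simpa using h.finite_fourth

/-- The bounded operator `A ↦ 𝔼[(I - γ x xᵀ) A (I - γ x xᵀ)]`. It agrees with `iterOp`, whose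
linearity and continuity in `A` are hidden by the definition. -/
noncomputable def iterMap (D : Measure (E × ℝ)) (γ : ℝ) : (E →L[ℝ] E) →L[ℝ] (E →L[ℝ] E) :=
  ∫ z, ContinuousLinearMap.mulLeftRight ℝ (E →L[ℝ] E) (1 - γ • outer z.1) (1 - γ • outer z.1) ∂D

lemma iterMap_apply_eq_integral [IsFiniteMeasure D] (h4 : MemLp Prod.fst 4 D) (γ : ℝ)
    (A : E →L[ℝ] E) :
    iterMap D γ A = ∫ z, (1 - γ • outer z.1) * A * (1 - γ • outer z.1) ∂D :=
  ContinuousLinearMap.integral_apply (integrable_mulLeftRight (memLp_one_sub_smul_outer h4 γ)) A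

lemma FourthMomentLower.isLowerStep {ι : Type*} {b : HilbertBasis ι ℝ E} {β : ℝ}
    (h : FourthMomentLower D b β) (γ ν : ℝ) {A : E →L[ℝ] E} (hA : 0 ≤ A) :
    IsLowerStep b (covOp D) β ν γ A (iterOp D γ A + (γ ^ 2 * ν) • covOp D) := by
  have lower := smul_le_smul_of_nonneg_left
    (h.lower A ((ContinuousLinearMap.nonneg_iff_isPositive A).1 hA)) (sq_nonneg γ)
  rw [IsLowerStep, one_sub_smul_mul_mul_one_sub_smul, iterOp, mul_add, add_smul, ← add_assoc]
  refine add_le_add_left ?_ _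
  rw [← sub_nonneg] at lower ⊢
  convert lower using 1
  simp only [smul_sub, smul_smul, ← sq]
  abel

variable [CompleteSpace E]

lemma sqNorm_covOp (h2 : MemLp Prod.fst 2 D) (a : E) :
    sqNorm (covOp D) a = ∫ z, ⟪z.1, a⟫ ^ 2 ∂D := by
  simp only [covOp, sqNorm_integral (integrable_outer h2), sqNorm_outer]

lemma isPosTraceClass_covOp (h2 : MemLp Prod.fst 2 D) {ι : Type*} {b : HilbertBasis ι ℝ E}
    {f : ι → ℝ} (hb : IsEigenbasis (covOp D) b f) : IsPosTraceClass (covOp D) b f := by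
  have eigenvalue_eq (i : ι) : f i = ∫ z, ⟪z.1, b i⟫ ^ 2 ∂D := by
    rw [hb.eigenvalue_eq, sqNorm_covOp h2]
  have eigenvalue_nonneg (i : ι) : 0 ≤ f i := by
    rw [eigenvalue_eq]
    exact integral_nonneg fun z => sq_nonneg _
  refine ⟨hb, eigenvalue_nonneg,
    summable_of_sum_le (c := ∫ z, ‖z.1‖ ^ 2 ∂D) eigenvalue_nonneg fun s => ?_⟩
  have integrable (i : ι) : Integrable (fun z => ⟪z.1, b i⟫ ^ 2) D :=
    (h2.inner_const (b i)).integrable_sq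
  simp only [eigenvalue_eq]
  rw [← integral_finsetSum _ fun i _ => integrable i]
  refine integral_mono (integrable_finsetSum _ fun i _ => integrable i)
    (h2.integrable_norm_pow two_ne_zero) fun z => ?_
  have bessel := b.orthonormal.sum_inner_products_le z.1 (s := s)
  simpa only [Real.norm_eq_abs, sq_abs, real_inner_comm] using bessel

lemma iterMap_apply [IsProbabilityMeasure D] (h4 : MemLp Prod.fst 4 D) (γ : ℝ) (A : E →L[ℝ] E) :
    iterMap D γ A = iterOp D γ A := by
  rw [iterMap_apply_eq_integral h4, integral_one_sub_smul_mul_mul_one_sub_smul (memLp_outer h4),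
    iterOp, covOp, fourthOp]

end Moments

/-! ### Label noise -/

section Noise

variable {E : Type*} [NormedAddCommGroup E] [InnerProductSpace ℝ E]

/-- The residual `y - ⟪w, x⟫` of the predictor `w`; for `w = w*` it is the label noise `ε`. -/
def residual (w : E) (z : E × ℝ) : ℝ := z.2 - ⟪w, z.1⟫

lemma residual_eq_residual_sub (w wstar : E) (z : E × ℝ) :
    residual w z = residual wstar z - ⟪z.1, w - wstar⟫ := by
  rw [residual, residual, inner_sub_right, real_inner_comm w, real_inner_comm wstar]
  ring

variable [MeasurableSpace E] {D : Measure (E × ℝ)} {wstar : E} {σ : ℝ}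

/-- Under `D` the label noise of the predictor `wstar` is independent of the covariates, has mean
zero and variance `σ²`. -/
structure CentredNoise (D : Measure (E × ℝ)) (wstar : E) (σ : ℝ) : Prop where
  memLp : MemLp (residual wstar) 2 D
  integral_eq_zero : ∫ z, residual wstar z ∂D = 0
  integral_sq : ∫ z, residual wstar z ^ 2 ∂D = σ ^ 2
  indepFun : IndepFun Prod.fst (residual wstar) D

lemma WellSpecified.centredNoise (h : WellSpecified D wstar σ) : CentredNoise D wstar σ := by
  have mean : ∫ z, residual wstar z ∂D = 0 :=
    h.noise_law.integral_eq.trans integral_id_gaussianReal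
  refine ⟨MemLp.comp_of_map (g := id) ?_ h.noise_law.aemeasurable, mean, ?_, h.noise_indep⟩
  · rw [h.noise_law.map_eq]
    exact memLp_id_gaussianReal 2
  · have variance := h.noise_law.variance_eq.trans variance_id_gaussianReal
    rw [variance_eq_integral h.noise_law.aemeasurable] at variance
    change ∫ z, (residual wstar z - ∫ z, residual wstar z ∂D) ^ 2 ∂D = σ ^ 2 at variance
    simpa only [mean, sub_zero] using variance

namespace CentredNoise

section

variable {F : Type*} [NormedAddCommGroup F] [NormedSpace ℝ F] {φ : E → F}

lemma integral_residual_smul (h : CentredNoise D wstar σ) (hφ : StronglyMeasurable φ) :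
    ∫ z, residual wstar z • φ z.1 ∂D = 0 := by
  refine (h.indepFun.symm.integral_fun_comp_smul_comp (f := id) h.memLp.1.aemeasurable
    (by fun_prop) (by fun_prop) hφ.aestronglyMeasurable).trans ?_
  simp only [id_eq, h.integral_eq_zero, zero_smul]

lemma integral_residual_sq_smul (h : CentredNoise D wstar σ) (hφ : StronglyMeasurable φ) :
    ∫ z, residual wstar z ^ 2 • φ z.1 ∂D = σ ^ 2 • ∫ z, φ z.1 ∂D := by
  rw [h.indepFun.symm.integral_fun_comp_smul_comp (f := (· ^ 2)) h.memLp.1.aemeasurable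
    (by fun_prop) (by fun_prop) hφ.aestronglyMeasurable, h.integral_sq]

end

lemma memLp_residual_smul [BorelSpace E] [SecondCountableTopology E] (h : CentredNoise D wstar σ)
    (h2 : MemLp Prod.fst 2 D) : MemLp (fun z => residual wstar z • z.1) 2 D := by
  have measurable : AEStronglyMeasurable (fun z => residual wstar z • z.1) D :=
    h.memLp.1.smul h2.1
  rw [memLp_two_iff_integrable_sq_norm measurable]
  have indep : IndepFun (fun z => residual wstar z ^ 2) (fun z => ‖z.1‖ ^ 2) D :=
    h.indepFun.symm.comp (φ := (· ^ 2)) (ψ := (‖·‖ ^ 2)) (by fun_prop) (by fun_prop)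
  simp only [norm_smul, mul_pow, Real.norm_eq_abs, sq_abs]
  exact indep.integrable_mul h.memLp.integrable_sq (h2.integrable_norm_pow two_ne_zero)

lemma noiseOp_eq [BorelSpace E] [SecondCountableTopology E] (h : CentredNoise D wstar σ) :
    noiseOp D wstar = σ ^ 2 • covOp D :=
  h.integral_residual_sq_smul continuous_outer.stronglyMeasurable

lemma excessRisk_eq [CompleteSpace E] [BorelSpace E] [SecondCountableTopology E]
    (h : CentredNoise D wstar σ) (h2 : MemLp Prod.fst 2 D) (w : E) :
    excessRisk D wstar w = (1 / 2) * sqNorm (covOp D) (w - wstar) := by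
  have error : MemLp (fun z : E × ℝ => ⟪z.1, w - wstar⟫) 2 D := h2.inner_const (w - wstar)
  have cross_eq_zero : ∫ z, residual wstar z * ⟪z.1, w - wstar⟫ ∂D = 0 :=
    h.integral_residual_smul (φ := (⟪·, w - wstar⟫)) (by fun_prop)
  have cross : Integrable (fun z => 2 * (residual wstar z * ⟪z.1, w - wstar⟫)) D :=
    (h.memLp.integrable_mul error).const_mul 2
  have reduced : Integrable
      (fun z => residual wstar z ^ 2 - 2 * (residual wstar z * ⟪z.1, w - wstar⟫)) D :=
    h.memLp.integrable_sq.sub cross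
  have expand : ∫ z, residual w z ^ 2 ∂D =
      ∫ z, residual wstar z ^ 2 ∂D + ∫ z, ⟪z.1, w - wstar⟫ ^ 2 ∂D := by
    simp only [residual_eq_residual_sub w wstar, sub_sq, mul_assoc]
    rw [integral_add reduced error.integrable_sq,
      integral_sub h.memLp.integrable_sq cross, integral_const_mul, cross_eq_zero, mul_zero,
      sub_zero]
  rw [excessRisk, risk, risk, sqNorm_covOp h2]
  change 1 / 2 * ∫ z, residual w z ^ 2 ∂D - 1 / 2 * ∫ z, residual wstar z ^ 2 ∂D = _
  rw [expand]
  ring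

end CentredNoise

end Noise

/-! ### Second moments of the SGD error -/

section SecondMoment

variable {E : Type*} [NormedAddCommGroup E] [InnerProductSpace ℝ E]

/-- One SGD step in terms of the error `v = w - w*`: it becomes `(I - γ x xᵀ) v + γ ε x`. -/
noncomputable def errStep (γ : ℝ) (wstar v : E) (z : E × ℝ) : E :=
  (1 - γ • outer z.1) v + γ • residual wstar z • z.1

lemma one_sub_smul_outer_apply (γ : ℝ) (x v : E) :
    (1 - γ • outer x) v = v - γ • ⟪x, v⟫ • x := by
  rw [sub_apply, one_apply_eq_self, smul_apply, outer_apply]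

lemma sgd_succ_sub (γ : ℕ → ℝ) (w₀ wstar : E) (z : ℕ → E × ℝ) (t : ℕ) :
    sgd γ w₀ z (t + 1) - wstar = errStep (γ t) wstar (sgd γ w₀ z t - wstar) (z t) := by
  simp only [sgd, errStep, residual, one_sub_smul_outer_apply, outer_apply, inner_sub_right,
    real_inner_comm wstar]
  module

lemma outer_add (x y : E) : outer (x + y) =
    outer x + (InnerProductSpace.rankOne ℝ x y + InnerProductSpace.rankOne ℝ y x) + outer y := by
  simp only [outer, map_add, add_apply]
  abel

lemma outer_smul (r : ℝ) (x : E) : outer (r • x) = r ^ 2 • outer x := by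
  ext y
  simp only [outer_apply, inner_smul_left, smul_apply, smul_smul, conj_trivial]
  ring_nf

lemma outer_one_sub_smul_outer_apply (γ : ℝ) (x v : E) :
    outer ((1 - γ • outer x) v) = (1 - γ • outer x) * outer v * (1 - γ • outer x) := by
  refine (conj_outer (fun y z => ?_) v).symm
  simp only [ContinuousLinearMap.coe_coe, one_sub_smul_outer_apply, inner_sub_left, inner_sub_right,
    real_inner_smul_left, real_inner_smul_right, real_inner_comm x y]
  ring

lemma integral_outer_add {α : Type*} [MeasurableSpace α] {ρ : Measure α} {X Y : α → E}
    (hX : MemLp X 2 ρ) (hY : MemLp Y 2 ρ)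
    (cross_eq_zero : ∫ a, InnerProductSpace.rankOne ℝ (X a) (Y a) +
      InnerProductSpace.rankOne ℝ (Y a) (X a) ∂ρ = 0) :
    ∫ a, outer (X a + Y a) ∂ρ = ∫ a, outer (X a) ∂ρ + ∫ a, outer (Y a) ∂ρ := by
  have sum : Integrable (fun a => outer (X a + Y a)) ρ := integrable_outer (hX.add hY)
  have diff : Integrable (fun a => outer (X a + Y a) - outer (X a)) ρ :=
    sum.sub (integrable_outer hX)
  have cross (a : α) : InnerProductSpace.rankOne ℝ (X a) (Y a) +
      InnerProductSpace.rankOne ℝ (Y a) (X a) =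
        outer (X a + Y a) - outer (X a) - outer (Y a) := by
    rw [outer_add]
    abel
  simp only [cross] at cross_eq_zero
  rwa [integral_sub diff (integrable_outer hY), integral_sub sum (integrable_outer hX), sub_sub,
    sub_eq_zero] at cross_eq_zero

variable [MeasurableSpace E] [BorelSpace E] [SecondCountableTopology E] {D : Measure (E × ℝ)}
  {wstar : E} {σ : ℝ}

lemma memLp_errStep {ρ : Measure E} [IsFiniteMeasure ρ] [IsFiniteMeasure D]
    (hD : CentredNoise D wstar σ) (h4 : MemLp Prod.fst 4 D) (hρ : MemLp id 2 ρ) (γ : ℝ) :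
    MemLp (fun p : E × E × ℝ => errStep γ wstar p.1 p.2) 2 (ρ.prod D) := by
  have noise : MemLp (fun z => residual wstar z • z.1) 2 D :=
    hD.memLp_residual_smul (h4.mono_exponent (by norm_num))
  have linear : MemLp (fun p : E × E × ℝ => (1 - γ • outer p.2.1) p.1) 2 (ρ.prod D) := by
    have measurable : AEStronglyMeasurable (fun p : E × E × ℝ => (1 - γ • outer p.2.1) p.1)
        (ρ.prod D) := by
      simp only [one_sub_smul_outer_apply]
      fun_prop
    rw [memLp_two_iff_integrable_sq_norm measurable]
    refine ((hρ.integrable_norm_pow two_ne_zero).mul_prod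
      ((memLp_one_sub_smul_outer h4 γ).integrable_norm_pow two_ne_zero)).mono'
      (measurable.norm.pow 2) (ae_of_all _ fun p => ?_)
    rw [Real.norm_of_nonneg (by positivity), ← mul_pow, mul_comm]
    exact pow_le_pow_left₀ (norm_nonneg _) (ContinuousLinearMap.le_opNorm _ _) 2
  exact linear.add ((noise.comp_snd ρ).const_smul γ)

lemma integral_outer_errStep_const [IsProbabilityMeasure D] (hD : CentredNoise D wstar σ)
    (h4 : MemLp Prod.fst 4 D) (γ : ℝ) (v : E) :
    ∫ z, outer (errStep γ wstar v z) ∂D = iterMap D γ (outer v) + γ ^ 2 • noiseOp D wstar := by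
  have linear_memLp : MemLp (fun z => (1 - γ • outer z.1) v) 2 D :=
    (ContinuousLinearMap.apply ℝ E v).comp_memLp' (memLp_one_sub_smul_outer h4 γ)
  have noise_memLp : MemLp (fun z => γ • residual wstar z • z.1) 2 D :=
    (hD.memLp_residual_smul (h4.mono_exponent (by norm_num))).const_smul γ
  let cross (x : E) : E →L[ℝ] E := γ • (InnerProductSpace.rankOne ℝ ((1 - γ • outer x) v) x +
    InnerProductSpace.rankOne ℝ x ((1 - γ • outer x) v))
  have cross_eq_zero : ∫ z, residual wstar z • cross z.1 ∂D = 0 := by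
    refine hD.integral_residual_smul (Continuous.stronglyMeasurable ?_)
    simp only [cross, InnerProductSpace.rankOne_def, one_sub_smul_outer_apply]
    fun_prop
  unfold errStep
  rw [integral_outer_add linear_memLp noise_memLp, iterMap_apply_eq_integral h4]
  · simp only [outer_one_sub_smul_outer_apply, outer_smul, integral_smul]
    rfl
  · simpa only [cross, map_smul, smul_apply, smul_add, smul_comm γ] using cross_eq_zero

variable [CompleteSpace E]

lemma integral_outer_errStep_prod {ρ : Measure E} [IsProbabilityMeasure ρ] [IsProbabilityMeasure D]
    (hD : CentredNoise D wstar σ) (h4 : MemLp Prod.fst 4 D) (hρ : MemLp id 2 ρ) (γ : ℝ) :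
    ∫ p : E × E × ℝ, outer (errStep γ wstar p.1 p.2) ∂(ρ.prod D) =
      iterMap D γ (∫ v, outer v ∂ρ) + γ ^ 2 • noiseOp D wstar := by
  rw [integral_prod _ (integrable_outer (memLp_errStep hD h4 hρ γ))]
  simp only [integral_outer_errStep_const hD h4]
  have second_moment : Integrable (fun v => outer v) ρ := integrable_outer hρ
  rw [integral_add ((iterMap D γ).integrable_comp second_moment) (integrable_const _),
    (iterMap D γ).integral_comp_comm second_moment, integral_const, probReal_univ, one_smul]

end SecondMoment

/-! ### Bias–variance decomposition of the excess risk -/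

lemma phaseLaw_cases {E : Type*} [MeasurableSpace E] {DS DT : Measure (E × ℝ)}
    {p : Measure (E × ℝ) → Prop} (hS : p DS) (hT : p DT) (M t : ℕ) : p (phaseLaw DS DT M t) := by
  unfold phaseLaw
  split_ifs
  exacts [hS, hT]

lemma phaseLaw_of_lt {E : Type*} [MeasurableSpace E] {DS DT : Measure (E × ℝ)} {M t : ℕ}
    (h : t < M) : phaseLaw DS DT M t = DS := if_pos h

lemma phaseLaw_add {E : Type*} [MeasurableSpace E] {DS DT : Measure (E × ℝ)} (M t : ℕ) :
    phaseLaw DS DT M (M + t) = DT := if_neg (by lia)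

section BiasVariance

variable {E : Type*} [NormedAddCommGroup E] [InnerProductSpace ℝ E]

lemma sgd_congr {γ : ℕ → ℝ} {w₀ : E} {z z' : ℕ → E × ℝ} {t : ℕ} (h : ∀ s < t, z s = z' s) :
    sgd γ w₀ z t = sgd γ w₀ z' t := by
  induction t with
  | zero => rfl
  | succ t ih => rw [sgd, sgd, ih fun s hs => h s (by lia), h t (by lia)]

variable [MeasurableSpace E] [BorelSpace E] [SecondCountableTopology E]

lemma measurable_sgd (γ : ℕ → ℝ) (w₀ : E) (t : ℕ) :
    Measurable fun z : ℕ → E × ℝ => sgd γ w₀ z t := by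
  induction t with
  | zero => exact measurable_const
  | succ t ih =>
    simp only [sgd, outer_apply]
    fun_prop

lemma exists_measurable_sgd_eq (γ : ℕ → ℝ) (w₀ : E) {n : ℕ} (t : Fin n) :
    ∃ φ : (Finset.Iio t → E × ℝ) → E, Measurable φ ∧
      ∀ z : ℕ → E × ℝ, sgd γ w₀ z t = φ fun i => z (i : Fin n) := by
  refine ⟨fun y => sgd γ w₀ (fun s => if h : s < t then
    y ⟨⟨s, h.trans t.2⟩, Finset.mem_Iio.2 h⟩ else 0) t, ?_, fun z => sgd_congr fun s hs => ?_⟩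
  · refine (measurable_sgd γ w₀ t).comp (measurable_pi_lambda _ fun s => ?_)
    split_ifs <;> fun_prop
  · simp only [hs, ↓reduceDIte]

variable {Ω : Type*} [MeasurableSpace Ω] {P : Measure Ω}

lemma indepFun_sgd (γ : ℕ → ℝ) (w₀ : E) {Z : ℕ → Ω → E × ℝ} {n : ℕ}
    (hZ : ∀ t < n, AEMeasurable (Z t) P) (hind : iIndepFun (fun t : Fin n => Z t) P) (t : Fin n) :
    IndepFun (fun ω => sgd γ w₀ (fun s => Z s ω) t) (Z t) P := by
  obtain ⟨φ, hφ, sgd_eq⟩ := exists_measurable_sgd_eq γ w₀ t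
  simp only [sgd_eq]
  have disjoint : Disjoint (Finset.Iio t) {t} := by simp
  exact (hind.indepFun_finset₀ _ _ disjoint fun i => hZ i i.2).comp hφ
    (measurable_pi_apply (⟨t, Finset.mem_singleton_self t⟩ : ({t} : Finset (Fin n))))

lemma memLp_errStep_comp [IsProbabilityMeasure P] {D : Measure (E × ℝ)} [IsProbabilityMeasure D]
    {wstar : E} {σ : ℝ} (hD : CentredNoise D wstar σ) (h4 : MemLp Prod.fst 4 D) {X : Ω → E}
    {Z : Ω → E × ℝ} (hX : MemLp X 2 P) (hZ : HasLaw Z D P) (hXZ : IndepFun X Z P) (γ : ℝ) :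
    MemLp (fun ω => errStep γ wstar (X ω) (Z ω)) 2 P := by
  have law := hXZ.hasLaw_prod ⟨hX.1.aemeasurable, rfl⟩ hZ
  have hρ : MemLp id 2 (P.map X) := (memLp_map_measure_iff (by fun_prop) hX.1.aemeasurable).2 hX
  have error := memLp_errStep hD h4 hρ γ
  rw [← law.map_eq] at error
  exact error.comp_of_map law.aemeasurable

variable [CompleteSpace E] [IsProbabilityMeasure P]

lemma integral_outer_errStep {D : Measure (E × ℝ)} [IsProbabilityMeasure D] {wstar : E} {σ : ℝ}
    (hD : CentredNoise D wstar σ) (h4 : MemLp Prod.fst 4 D) {X : Ω → E} {Z : Ω → E × ℝ}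
    (hX : MemLp X 2 P) (hZ : HasLaw Z D P) (hXZ : IndepFun X Z P) (γ : ℝ) :
    ∫ ω, outer (errStep γ wstar (X ω) (Z ω)) ∂P =
      iterMap D γ (∫ ω, outer (X ω) ∂P) + γ ^ 2 • noiseOp D wstar := by
  have law := hXZ.hasLaw_prod ⟨hX.1.aemeasurable, rfl⟩ hZ
  have hρ : MemLp id 2 (P.map X) := (memLp_map_measure_iff (by fun_prop) hX.1.aemeasurable).2 hX
  have : IsProbabilityMeasure (P.map X) := Measure.isProbabilityMeasure_map hX.1.aemeasurable
  rw [← integral_map hX.1.aemeasurable continuous_outer.aestronglyMeasurable,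
    ← integral_outer_errStep_prod hD h4 hρ γ]
  exact law.integral_comp (integrable_outer (memLp_errStep hD h4 hρ γ)).1

section Iterates

variable {DS DT : Measure (E × ℝ)} [IsProbabilityMeasure DS] [IsProbabilityMeasure DT]
  {wstar : E} {σ : ℝ} {M n : ℕ} {Z : ℕ → Ω → E × ℝ}

lemma sgd_second_moment (hS : CentredNoise DS wstar σ) (hT : CentredNoise DT wstar σ)
    (hS4 : MemLp Prod.fst 4 DS) (hT4 : MemLp Prod.fst 4 DT)
    (hind : iIndepFun (fun t : Fin n => Z t) P) (hZ : ∀ t < n, HasLaw (Z t) (phaseLaw DS DT M t) P)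
    (γ : ℕ → ℝ) (w₀ : E) {t : ℕ} (ht : t ≤ n) :
    MemLp (fun ω => sgd γ w₀ (fun s => Z s ω) t - wstar) 2 P ∧
      ∫ ω, outer (sgd γ w₀ (fun s => Z s ω) t - wstar) ∂P =
        biasIter DS DT M γ w₀ wstar t + varIter DS DT M γ wstar t := by
  induction t with
  | zero =>
    simp only [sgd, biasIter, varIter, integral_const, probReal_univ, one_smul, add_zero]
    exact ⟨memLp_const _, trivial⟩
  | succ t ih =>
    obtain ⟨memLp, moment⟩ := ih (by lia)
    have probability : IsProbabilityMeasure (phaseLaw DS DT M t) :=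
      phaseLaw_cases ‹_› ‹_› M t
    have noise : CentredNoise (phaseLaw DS DT M t) wstar σ :=
      phaseLaw_cases (p := (CentredNoise · wstar σ)) hS hT M t
    have fourth : MemLp Prod.fst 4 (phaseLaw DS DT M t) :=
      phaseLaw_cases (p := (MemLp Prod.fst 4 ·)) hS4 hT4 M t
    have indep := (indepFun_sgd γ w₀ (fun s hs => (hZ s hs).aemeasurable) hind ⟨t, ht⟩).comp
      (measurable_id.sub_const wstar) measurable_id
    simp only [sgd_succ_sub]
    refine ⟨memLp_errStep_comp noise fourth memLp (hZ t ht) indep _, ?_⟩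
    rw [integral_outer_errStep noise fourth memLp (hZ t ht) indep, moment, map_add,
      iterMap_apply fourth, iterMap_apply fourth, biasIter, varIter, add_assoc]

end Iterates

end BiasVariance

/-! ### Lower bounds for the bias and the variance -/

section LowerBound

variable {E : Type*} [NormedAddCommGroup E] [InnerProductSpace ℝ E] [CompleteSpace E]
  [SecondCountableTopology E] [MeasurableSpace E] [BorelSpace E] {DS DT : Measure (E × ℝ)}
  [IsProbabilityMeasure DS] [IsProbabilityMeasure DT] {ι κ : Type*} {bG : HilbertBasis ι ℝ E}
  {μ : ι → ℝ} {bH : HilbertBasis κ ℝ E} {ev : κ → ℝ} {β σ : ℝ} {wstar : E} {M N : ℕ}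

lemma FourthMomentLower.isPosTraceClass (h : FourthMomentLower DS bG β)
    (hG : IsEigenbasis (covOp DS) bG μ) : IsPosTraceClass (covOp DS) bG μ :=
  isPosTraceClass_covOp (h.memLp.mono_exponent (by norm_num)) hG

lemma integral_excessRisk_sgd (hH : IsEigenbasis (covOp DT) bH ev)
    (hS4 : MemLp Prod.fst 4 DS) (hT4 : MemLp Prod.fst 4 DT) (hS : CentredNoise DS wstar σ)
    (hT : CentredNoise DT wstar σ) {Ω : Type*} [MeasurableSpace Ω] {P : Measure Ω}
    [IsProbabilityMeasure P] {Z : ℕ → Ω → E × ℝ} (hind : iIndepFun (fun t : Fin (M + N) => Z t) P)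
    (hZ : ∀ t < M + N, HasLaw (Z t) (phaseLaw DS DT M t) P) (γ : ℕ → ℝ) (w₀ : E) :
    Integrable (fun ω => excessRisk DT wstar (sgd γ w₀ (fun t => Z t ω) (M + N))) P ∧
      ∫ ω, excessRisk DT wstar (sgd γ w₀ (fun t => Z t ω) (M + N)) ∂P =
        biasErr bH DS DT M N γ w₀ wstar + varErr bH DS DT M N γ wstar := by
  have hT2 : MemLp Prod.fst 2 DT := hT4.mono_exponent (by norm_num)
  have hH' := isPosTraceClass_covOp hT2 hH
  obtain ⟨memLp, moment⟩ := sgd_second_moment hS hT hS4 hT4 hind hZ γ w₀ le_rfl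
  obtain ⟨integrable, integral_eq⟩ := hH'.integrable_sqNorm memLp
  simp only [hT.excessRisk_eq hT2]
  refine ⟨integrable.const_mul _, ?_⟩
  rw [integral_const_mul, integral_eq, moment, hH'.trace_mul_add, mul_add, biasErr, varErr]

variable {γ₀ γM : ℝ}

lemma le_varErr (hG : IsEigenbasis (covOp DS) bG μ) (hH : IsEigenbasis (covOp DT) bH ev)
    (hβ : 0 ≤ β) (hS : FourthMomentLower DS bG β) (hT : FourthMomentLower DT bH β)
    (hSn : CentredNoise DS wstar σ) (hTn : CentredNoise DT wstar σ) (hM : 10 ≤ nEff M)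
    (hN : 10 ≤ nEff N) (hγ₀ : 0 < γ₀) (hγM : 0 < γM) (hγG : γ₀ * ‖covOp DS‖ ≤ 1)
    (hγH : γM * ‖covOp DT‖ ≤ 1) :
    let γ := stepsize M N γ₀ γM
    let J : Set ι := {j | 1 / (γ₀ * nEff M) ≤ μ j}
    let K : Set κ := {k | 1 / (γM * nEff N) ≤ ev k}
    Real.exp (-18) / 8 * (σ ^ 2 * (dEffFinetune bG μ J bH (covOp DT) γ M N (nEff M * γ₀) / nEff M
      + dEff ev K (nEff N * γM) / nEff N)) ≤ varErr bH DS DT M N γ wstar := by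
  intro γ J K
  have lower := two_phase_ge (hS.isPosTraceClass hG) (hT.isPosTraceClass hH) hM hN hγ₀ hγM hγG hγH
    hβ (sq_nonneg σ) (A := varIter DS DT M γ wstar) (w := 0) (by simp [outer, varIter])
    (fun t ht hA => by
      rw [varIter, phaseLaw_of_lt ht, hSn.noiseOp_eq, smul_smul]
      exact hS.isLowerStep _ _ hA)
    fun t _ hA => by
      rw [varIter, phaseLaw_add, hTn.noiseOp_eq, smul_smul]
      exact hT.isLowerStep _ _ hA
  simp only [sqNorm, map_zero, inner_zero_left, mul_zero, zero_add] at lower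
  rw [varErr]
  linear_combination (1 / 2) * lower

lemma le_biasErr (hG : IsEigenbasis (covOp DS) bG μ) (hH : IsEigenbasis (covOp DT) bH ev)
    (hβ : 0 ≤ β) (hS : FourthMomentLower DS bG β) (hT : FourthMomentLower DT bH β)
    (hM : 10 ≤ nEff M) (hN : 10 ≤ nEff N) (hγ₀ : 0 < γ₀) (hγM : 0 < γM)
    (hγG : γ₀ * ‖covOp DS‖ ≤ 1) (hγH : γM * ‖covOp DT‖ ≤ 1) (w₀ wstar : E) :
    let γ := stepsize M N γ₀ γM
    let J : Set ι := {j | 1 / (γ₀ * nEff M) ≤ μ j}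
    let K : Set κ := {k | 1 / (γM * nEff N) ≤ ev k}
    let v := contraction γ (covOp DS) 0 M (w₀ - wstar)
    Real.exp (-18) / 8 * (sqNorm (covOp DT) (contraction γ (covOp DT) M N v)
        + β * sqNorm (specPart bG μ Jᶜ) (w₀ - wstar)
          * (dEffFinetune bG μ J bH (covOp DT) γ M N (nEff M * γ₀) / nEff M)
        + β * sqNorm (specPart bH ev Kᶜ) v * (dEff ev K (nEff N * γM) / nEff N))
      ≤ biasErr bH DS DT M N γ w₀ wstar := by
  intro γ J K v
  have lower := two_phase_ge (hS.isPosTraceClass hG) (hT.isPosTraceClass hH) hM hN hγ₀ hγM hγG hγH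
    hβ le_rfl (A := biasIter DS DT M γ w₀ wstar) (w := w₀ - wstar) le_rfl
    (fun t ht hA => by
      rw [biasIter, phaseLaw_of_lt ht]
      simpa only [mul_zero, zero_smul, add_zero] using hS.isLowerStep (γ t) 0 hA)
    fun t _ hA => by
      rw [biasIter, phaseLaw_add]
      simpa only [mul_zero, zero_smul, add_zero] using hT.isLowerStep (γ (M + t)) 0 hA
  have exp_le_one : Real.exp (-18) ≤ 1 := Real.exp_le_one_iff.2 (by norm_num)
  have contracted_nonneg := mul_nonneg (show 0 ≤ 1 / 2 - Real.exp (-18) / 8 by linarith)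
    (sqNorm_nonneg (hT.isPosTraceClass hH).nonneg (contraction γ (covOp DT) M N v))
  rw [biasErr]
  linear_combination (1 / 2) * lower + contracted_nonneg

end LowerBound

end CovShift

theorem theorem2_general {E : Type*} [NormedAddCommGroup E] [InnerProductSpace ℝ E]
    [CompleteSpace E] [SecondCountableTopology E] [MeasurableSpace E] [BorelSpace E]
    {DS DT : Measure (E × ℝ)} [IsProbabilityMeasure DS] [IsProbabilityMeasure DT] {ι κ : Type*}
    {bG : HilbertBasis ι ℝ E} {μ : ι → ℝ} {bH : HilbertBasis κ ℝ E} {ev : κ → ℝ}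
    {β σ : ℝ} {wstar : E} {M N : ℕ} {γ₀ γM : ℝ}
    (hG : IsEigenbasis (covOp DS) bG μ) (hH : IsEigenbasis (covOp DT) bH ev)
    (hβ : 0 ≤ β) (hσ : 0 < σ) (hS : FourthMomentLower DS bG β) (hT : FourthMomentLower DT bH β)
    (hSn : CentredNoise DS wstar σ) (hTn : CentredNoise DT wstar σ) (w₀ : E) (hM : 10 ≤ nEff M)
    (hN : 10 ≤ nEff N) (hγ₀ : 0 < γ₀) (hγM : 0 < γM) (hγG : γ₀ * ‖covOp DS‖ ≤ 1)
    (hγH : γM * ‖covOp DT‖ ≤ 1) {Ω : Type*} [MeasurableSpace Ω] {P : Measure Ω}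
    [IsProbabilityMeasure P] {Z : ℕ → Ω → E × ℝ} (hind : iIndepFun (fun t : Fin (M + N) => Z t) P)
    (hZ : ∀ t < M + N, HasLaw (Z t) (phaseLaw DS DT M t) P) :
    let c := Real.exp (-18) / 8
    let G := covOp DS
    let H := covOp DT
    let γ := stepsize M N γ₀ γM
    let w := fun ω => sgd γ w₀ (fun t => Z t ω) (M + N)
    let J : Set ι := {j | 1 / (γ₀ * nEff M) ≤ μ j}
    let K : Set κ := {k | 1 / (γM * nEff N) ≤ ev k}
    let D := dEff ev K (nEff N * γM)
    let Dft := dEffFinetune bG μ J bH H γ M N (nEff M * γ₀)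
    let v := contraction γ G 0 M (w₀ - wstar)
    let u := contraction γ H M N v
    let bias := biasErr bH DS DT M N γ w₀ wstar
    let var := varErr bH DS DT M N γ wstar
    let varRate := σ ^ 2 * (Dft / nEff M + D / nEff N)
    let biasLower := sqNorm H u
      + β * sqNorm (specPart bG μ Jᶜ) (w₀ - wstar) * (Dft / nEff M)
      + β * sqNorm (specPart bH ev Kᶜ) v * (D / nEff N)
    let headTail :=
      sqNorm (specPart bG (fun _ => 1 / (nEff M * γ₀)) J + specPart bG μ Jᶜ) (w₀ - wstar)
    let biasUpper := fun α : ℝ => sqNorm H u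
      + α * headTail * (Dft / nEff M)
      + α * (sqNorm (specPart bH (fun _ => 1 / (nEff N * γM)) K + specPart bH ev Kᶜ) v
          + headTail) * (D / nEff N)
    (Integrable (fun ω => excessRisk DT wstar (w ω)) P ∧
      ∫ ω, excessRisk DT wstar (w ω) ∂P = bias + var) ∧
    c * varRate ≤ var ∧
    c * biasLower ≤ bias ∧
    ∀ α R : ℝ, β ≤ α → sqNorm G (w₀ - wstar) ≤ R * σ ^ 2 → sqNorm H v ≤ R * σ ^ 2 →
      varRate + biasLower ≤ varRate + biasUpper α ∧
      c * (varRate + biasUpper α) ≤ (1 + α * R) * (varRate + biasLower) := by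
  intro c G H γ w J K D Dft v u bias var varRate biasLower headTail biasUpper
  refine ⟨integral_excessRisk_sgd hH hS.memLp hT.memLp hSn hTn hind hZ γ w₀,
    le_varErr hG hH hβ hS hT hSn hTn hM hN hγ₀ hγM hγG hγH,
    le_biasErr hG hH hβ hS hT hM hN hγ₀ hγM hγG hγH w₀ wstar, fun α R hα hRG hRH => ?_⟩
  have hM0 : 0 < nEff M := by linarith
  have hN0 : 0 < nEff N := by linarith
  have hG' := hS.isPosTraceClass hG
  have hH' := hT.isPosTraceClass hH
  have hJ : 0 < 1 / (γ₀ * nEff M) := by positivity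
  have hK : 0 < 1 / (γM * nEff N) := by positivity
  have c_le : c ≤ 1 / 2 := by
    have := Real.exp_le_one_iff.2 (show (-18 : ℝ) ≤ 0 by norm_num)
    simp only [c]
    linarith
  simp only [varRate, biasLower, biasUpper, headTail, mul_comm (nEff M) γ₀, mul_comm (nEff N) γM]
  exact lower_rate_le_and_mul_upper_rate_le hG' hH' hJ hK
    (div_nonneg (dEffFinetune_nonneg hG' hH' hJ γ M N _) hM0.le)
    (div_nonneg (dEff_nonneg ev K _) hN0.le)
    (sqNorm_nonneg hH'.nonneg u) hβ hα (by positivity) hRG hRH c_le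

theorem theorem2 :
    ∃ c : ℝ, 0 < c ∧
    ∀ (E : Type*) [NormedAddCommGroup E] [InnerProductSpace ℝ E] [CompleteSpace E]
      [SecondCountableTopology E] [MeasurableSpace E] [BorelSpace E]
      -- source and target distributions of `(x, y)`
      (DS DT : Measure (E × ℝ)) [IsProbabilityMeasure DS] [IsProbabilityMeasure DT]
      -- eigenvectors and eigenvalues of `G` and `H`
      (ι κ : Type*) (bG : HilbertBasis ι ℝ E) (μ : ι → ℝ) (bH : HilbertBasis κ ℝ E) (ev : κ → ℝ)
      (_ : IsEigenbasis (covOp DS) bG μ) (_ : IsEigenbasis (covOp DT) bH ev)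
      -- moment and noise conditions
      (β σ : ℝ) (wstar : E) (_ : 0 < β) (_ : 0 < σ)
      (_ : FourthMomentLower DS bG β) (_ : FourthMomentLower DT bH β)
      (_ : WellSpecified DS wstar σ) (_ : WellSpecified DT wstar σ)
      -- sample sizes, stepsizes and initialization
      (M N : ℕ) (γ₀ γM : ℝ) (w₀ : E) (_ : 10 ≤ nEff M) (_ : 10 ≤ nEff N)
      (_ : 0 < γ₀) (_ : 0 < γM) (_ : γ₀ * ‖covOp DS‖ < 1) (_ : γM * ‖covOp DT‖ < 1)
      -- independent samples: `M` from the source, then `N` from the target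
      (Ω : Type*) [MeasurableSpace Ω] (P : Measure Ω) [IsProbabilityMeasure P]
      (Z : ℕ → Ω → E × ℝ)
      (_ : iIndepFun (fun t : Fin (M + N) => Z t) P)
      (_ : ∀ t < M + N, HasLaw (Z t) (phaseLaw DS DT M t) P),
      let G := covOp DS
      let H := covOp DT
      let γ := stepsize M N γ₀ γM
      let w := fun ω => sgd γ w₀ (fun t => Z t ω) (M + N)
      let J : Set ι := {j | 1 / (γ₀ * nEff M) ≤ μ j}
      let K : Set κ := {k | 1 / (γM * nEff N) ≤ ev k}
      let D := dEff ev K (nEff N * γM)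
      let Dft := dEffFinetune bG μ J bH H γ M N (nEff M * γ₀)
      -- `∏_{t<M} (I - γ_t G) (w₀ - w*)` and `∏_{M≤t<M+N} (I - γ_t H) ∏_{t<M} (I - γ_t G) (w₀ - w*)`
      let v := contraction γ G 0 M (w₀ - wstar)
      let u := contraction γ H M N v
      let bias := biasErr bH DS DT M N γ w₀ wstar
      let var := varErr bH DS DT M N γ wstar
      let varRate := σ ^ 2 * (Dft / nEff M + D / nEff N)
      let biasLower := sqNorm H u
        + β * sqNorm (specPart bG μ Jᶜ) (w₀ - wstar) * (Dft / nEff M)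
        + β * sqNorm (specPart bH ev Kᶜ) v * (D / nEff N)
      -- the bias expression of the matching upper bound, for an upper fourth moment constant `α`
      let headTail :=
        sqNorm (specPart bG (fun _ => 1 / (nEff M * γ₀)) J + specPart bG μ Jᶜ) (w₀ - wstar)
      let biasUpper := fun α : ℝ => sqNorm H u
        + α * headTail * (Dft / nEff M)
        + α * (sqNorm (specPart bH (fun _ => 1 / (nEff N * γM)) K + specPart bH ev Kᶜ) v
            + headTail) * (D / nEff N)
      (Integrable (fun ω => excessRisk DT wstar (w ω)) P ∧
        ∫ ω, excessRisk DT wstar (w ω) ∂P = bias + var) ∧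
      c * varRate ≤ var ∧
      c * biasLower ≤ bias ∧
      -- up to constants the lower bound matches the upper bound for bounded signal-to-noise ratios
      ∀ α R : ℝ, β ≤ α → sqNorm G (w₀ - wstar) ≤ R * σ ^ 2 → sqNorm H v ≤ R * σ ^ 2 →
        varRate + biasLower ≤ varRate + biasUpper α ∧
        c * (varRate + biasUpper α) ≤ (1 + α * R) * (varRate + biasLower) :=
  ⟨Real.exp (-18) / 8, by positivity, fun _ _ _ _ _ _ _ _ _ _ _ _ _ _ _ _ _ hG hH _ _ _ hβ hσ
    hS hT hSn hTn _ _ _ _ w₀ hM hN hγ₀ hγM hγG hγH _ _ _ _ _ hind hZ =>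
      theorem2_general hG hH hβ.le hσ hS hT hSn.centredNoise hTn.centredNoise w₀ hM hN hγ₀ hγM
        hγG.le hγH.le hind hZ⟩
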